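/- Let $(X,\mu)$ be a standard probability space and let $\mathcal R\subset X\times X$ be a nonsingular equivalence relation on it: $\mathcal R$ is measurable, has countable classes, and the $\mathcal R$-saturation of every $\mu$-null set is $\mu$-null. Sets and maps are identified when they agree up to null sets. Assume that $\mathcal R$ is ergodic (every $\mathcal R$-invariant function in $L^\infty(X)$ is a.e. constant). For a $\sigma$-finite measure $\nu$ equivalent to $\mu$, define measures on $\mathcal R$ by $\nu_\ell(W)=\int_X\#\{y:(x,y)\in W\}\,d\nu(x)$ and $\nu_r(W)=\int_X\#\{x:(x,y)\in W\}\,d\nu(y)$, and let $\delta_\nu=\frac{d\nu_\ell}{d\nu_r}$; $\nu$ is $\mathcal R$-invariant if $\nu_\ell=\nu_r$. Let $S(\mathcal R)\subset[0,\infty)$ be the intersection of the essential ranges of $\delta_\nu$ (in $[0,\infty)$) over all such $\nu$. Let $0<\lambda\le 1$ and assume that $\mathcal R$ is of type $\mathrm{III}_\lambda$: no equivalence class is conull, no $\sigma$-finite measure equivalent to $\mu$ is $\mathcal R$-invariant, and $S(\mathcal R)=\{0\}\cup\lambda^{\mathbf Z}$ if $\lambda<1$, $S(\mathcal R)=[0,\infty)$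 if $\lambda=1$. The full pseudo-group $[[\mathcal R]]$ is the set of nonsingular partial isomorphisms $\theta:\mathrm{dom}(\theta)\to\mathrm{ran}(\theta)$ between measurable subsets of $X$ with $(x,\theta(x))\in\mathcal R$ for a.e. $x\in\mathrm{dom}(\theta)$, and the full group $[\mathcal R]$ consists of those with $\mathrm{dom}(\theta)=\mathrm{ran}(\theta)=X$, with the topology of the metric $d_\mu(\theta,\theta')=\mu(\{x:\theta(x)\neq\theta'(x)\})$. An element $\theta\in[[\mathcal R]]$ is $\mu$-bounded if $\log\frac{d(\mu\circ\theta)}{d\mu}$ is essentially bounded on $\mathrm{dom}(\theta)$, where $(\mu\circ\theta)(E)=\mu(\theta(E\cap \mathrm{dom}(\theta)))$. Then: 1. For all measurable $A,B\subset X$ with $\mu(A)>0$ and $\mu(B)>0$, there is a $\mu$-bounded $\theta\in[[\mathcal R]]$ with $\mathrm{dom}(\theta)=A$ and $\mathrm{ran}(\theta)=B$. More precisely, for every $0<C<\lambda$ one can choose such a $\theta$ with $$C\,\frac{\mu(B)}{\mu(A)}\le\frac{d(\mu\circ\theta)}{d\mu}(x)\le C^{-1}\,\frac{\mu(B)}{\mu(A)}\qquad\text{for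 a.e. }x\in A.$$ 2. The $\mu$-bounded elements of $[\mathcal R]$ are dense in $[\mathcal R]$. -/

import Mathlib

open MeasureTheory Set

namespace NonsingularRelation

noncomputable section

variable {X : Type*} [MeasurableSpace X]

/-- The graph `{(x, y) | x ~ y}` of an equivalence relation, as a subset of `X × X`. -/
def graph (R : Setoid X) : Set (X × X) := {p | R p.1 p.2}

/-- The standing assumptions on an equivalence relation on a standard measure space:
measurable, with countable classes, and nonsingular. -/
structure IsNonsingular (R : Setoid X) (μ : Measure X) : Prop where
  measurableSet_graph : MeasurableSet (graph R)
  countable_class : ∀ x, {y | R x y}.Countable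
  saturation_null : ∀ N : Set X, μ N = 0 → μ {y | ∃ x ∈ N, R x y} = 0

/-- Ergodicity: every `R`-invariant function in `L^∞(X)` is constant. A property holds for
a.e. `(x, y) ∈ R` when its set of exceptions in `R` has null projection to `X`. -/
def IsErgodic (R : Setoid X) (μ : Measure X) : Prop :=
  ∀ f : X → ℂ, MemLp f ⊤ μ → (∀ᵐ x ∂μ, ∀ y, R x y → f x = f y) →
    ∃ c : ℂ, ∀ᵐ x ∂μ, f x = c

/-- `𝓜(X)`: the `σ`-finite measures in the measure class of `μ`. -/
def measureClass (μ : Measure X) : Set (Measure X) :=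
  {ν | SigmaFinite ν ∧ ν ≪ μ ∧ μ ≪ ν}

/-- The measure `μ_ℓ(W) = ∫ #{y | (x, y) ∈ W} dμ(x)` for `W ⊆ R`, viewed as a measure on `X × X`
that is concentrated on `R`. (The integrand is measurable in `x` because `R` is a measurable
subset of `X × X` with countable sections.) -/
def leftMeasure (R : Setoid X) (μ : Measure X) : Measure (X × X) :=
  μ.bind fun x => Measure.count.restrict {p | p ∈ graph R ∧ p.1 = x}

/-- The measure `μ_r(W) = ∫ #{x | (x, y) ∈ W} dμ(y)` for `W ⊆ R`, viewed as a measure on `X × X`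
that is concentrated on `R`. -/
def rightMeasure (R : Setoid X) (μ : Measure X) : Measure (X × X) :=
  μ.bind fun y => Measure.count.restrict {p | p ∈ graph R ∧ p.2 = y}

/-- `μ` is `R`-invariant if `μ_ℓ = μ_r`. -/
def IsInvariant (R : Setoid X) (μ : Measure X) : Prop :=
  leftMeasure R μ = rightMeasure R μ

/-- The modulus `δ_μ = dμ_ℓ / dμ_r`. -/
def modulus (R : Setoid X) (μ : Measure X) : X × X → ℝ :=
  fun p => ((leftMeasure R μ).rnDeriv (rightMeasure R μ) p).toReal

/-- The essential range of the modulus: the topological support of its push-forward measure. -/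
def essRangeModulus (R : Setoid X) (μ : Measure X) : Set ℝ :=
  ((rightMeasure R μ).map (modulus R μ)).support

/-- The invariant `S(R)`, the intersection of the essential ranges of `δ_ν` over all `σ`-finite
measures `ν` in the measure class of `μ`. -/
def SInvariant (R : Setoid X) (μ : Measure X) : Set ℝ :=
  ⋂ ν ∈ measureClass μ, essRangeModulus R ν

/-- Type I: only one equivalence class, up to measure zero. -/
def IsTypeI (R : Setoid X) (μ : Measure X) : Prop :=
  ∃ x, ∀ᵐ y ∂μ, R x y

/-- Type II₁. -/
def IsTypeII₁ (R : Setoid X) (μ : Measure X) : Prop :=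
  ¬ IsTypeI R μ ∧ ∃ ν ∈ measureClass μ, IsProbabilityMeasure ν ∧ IsInvariant R ν

/-- Type II_∞. -/
def IsTypeIIInf (R : Setoid X) (μ : Measure X) : Prop :=
  ¬ IsTypeI R μ ∧ ∃ ν ∈ measureClass μ, ν univ = ⊤ ∧ IsInvariant R ν

/-- Type III: neither of type I nor of type II. -/
def IsTypeIII (R : Setoid X) (μ : Measure X) : Prop :=
  ¬ IsTypeI R μ ∧ ¬ IsTypeII₁ R μ ∧ ¬ IsTypeIIInf R μ

/-- Type III_λ for `0 < λ ≤ 1`: the relation is of type III, and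
`S(R) = {0} ∪ λ^ℤ` if `λ < 1`, respectively `S(R) = [0, ∞)` if `λ = 1`. -/
def IsTypeIIIParam (R : Setoid X) (μ : Measure X) (l : ℝ) : Prop :=
  IsTypeIII R μ ∧
    ((0 < l ∧ l < 1 ∧ SInvariant R μ = {0} ∪ range (fun n : ℤ => l ^ n)) ∨
      (l = 1 ∧ SInvariant R μ = Ici 0))

/-- Nonsingular partial isomorphisms of `(X, μ)`: measurable bijections with measurable inverse
between measurable subsets, which preserve the null sets in both directions. -/
structure IsPartialIso (μ : Measure X) (θ : PartialEquiv X X) : Prop where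
  measurableSet_source : MeasurableSet θ.source
  measurableSet_target : MeasurableSet θ.target
  measurable_toFun : Measurable (θ.source.domRestrict θ)
  measurable_invFun : Measurable (θ.target.domRestrict θ.symm)
  null_iff : ∀ N, N ⊆ θ.source → (μ (θ '' N) = 0 ↔ μ N = 0)

/-- The full pseudo-group `[[R]]` (given by representatives modulo null sets). -/
def fullPseudogroup (R : Setoid X) (μ : Measure X) : Set (PartialEquiv X X) :=
  {θ | IsPartialIso μ θ ∧ ∀ᵐ x ∂μ, x ∈ θ.source → R x (θ x)}

/-- The measure `μ ∘ θ : E ↦ μ (θ (E ∩ dom θ))`. -/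
def compMeasure (μ : Measure X) (θ : PartialEquiv X X) : Measure X :=
  (μ.restrict θ.target).map θ.symm

/-- The Radon–Nikodym derivative `d(μ ∘ θ) / dμ`. -/
def derivative (μ : Measure X) (θ : PartialEquiv X X) : X → ℝ :=
  fun x => ((compMeasure μ θ).rnDeriv μ x).toReal

/-- A partial isomorphism `θ` is `μ`-bounded if `log (d(μ ∘ θ) / dμ)` is (essentially) bounded
on its domain. For a nonsingular `θ`, the derivative lies in `(0, ∞)` almost everywhere there. -/
def IsMuBounded (μ : Measure X) (θ : PartialEquiv X X) : Prop :=
  ∃ K : ℝ, ∀ᵐ x ∂μ, x ∈ θ.source → |Real.log (derivative μ θ x)| ≤ K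

/-- The full group `[R]`: the invertible elements of `[[R]]`, i.e. those whose domain and range
are conull (given by representatives modulo null sets). -/
def FullGroup (R : Setoid X) (μ : Measure X) : Type _ :=
  {θ : PartialEquiv X X //
    θ ∈ fullPseudogroup R μ ∧ θ.source =ᵐ[μ] univ ∧ θ.target =ᵐ[μ] univ}

/-- The topology of `[R]`, given by `d_μ(θ, θ') = μ {x | θ x ≠ θ' x}`. It is a pseudo-metric on
representatives, and the distance is zero exactly when the two define the same element of `[R]`. -/
instance (R : Setoid X) (μ : Measure X) [IsProbabilityMeasure μ] :
    PseudoMetricSpace (FullGroup R μ) where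
  dist θ θ' := μ.real {x | θ.1 x ≠ θ'.1 x}
  dist_self θ := by simp
  dist_comm θ θ' := by simp only [ne_comm]
  dist_triangle θ θ' θ'' := by
    refine (measureReal_mono (fun x hx => ?_)).trans (measureReal_union_le _ _)
    by_contra h
    simp only [mem_union, mem_ofPred_eq, not_or, not_not] at h
    exact hx (h.1.trans h.2)

end

end NonsingularRelation

/-! Elements of `[[R]]` are handled through their graphs, the bisections of $R$: measurable subsets
on which both coordinates are injective. A Lusin–Novikov theorem cuts $R$, up to null sets, into
countably many bisections. Hence $\mu_\ell$ and $\mu_r$ are σ-finite and equivalent, and on a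
bisection the modulus is the Radon–Nikodym ratio of the partial isomorphism, up to inversion.
`HasRatio` records bounds on this ratio, which multiply under composition.

The intersection defining $S(R)$ runs over all measures in the class, and this localises it. By
ergodicity there is a map $\varphi$ from $X$ into any given nonnull $A$ with graph in $R$. Pulling
$\mu$ back through $\varphi$, piece by piece, gives a σ-finite $\nu$; conjugating by $\varphi$ turns
a partial isomorphism of $\nu$-ratio near $t\in S(R)$ into one inside $A$ of $\mu$-ratio near $t$
(`exists_hasRatio_of_mem_SInvariant`). Two nonnull sets are always joined by a partial isomorphism
of almost constant ratio. Correcting it by a power of $\lambda$ (of a number in $(C,1)$ if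
$\lambda=1$) brings the ratio into $[Cm,m]$ for any prescribed $m$ (`exists_hasRatio_of_typeIII`).

Take $m=\mu(B)/\mu(A)$. A maximal disjoint family of such pieces exhausts $A$: if it exhausts $B$,
the upper bound $m$ forces its source to have measure at least $\mu(A)$. The same holds from $B$ to
$A$, and a Cantor–Bernstein argument merges the two maps into one of ratio in $[Cm,C^{-1}m]$
(`exists_hasRatio_full`). For density, $\theta\in[R]$ is kept where its modulus lies in a compact
subset of $(0,\infty)$, and the small leftover sets are matched by the comparison theorem. -/

namespace NonsingularRelation

/-! ### Universal measurability of analytic sets -/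

section AnalyticSets

open Filter Topology

/-- An analytic set can be approximated in measure from inside by compact sets. -/
theorem exists_isCompact_subset_range {X : Type*} [TopologicalSpace X] [PolishSpace X]
    [MeasurableSpace X] [BorelSpace X] (μ : Measure X) [IsFiniteMeasure μ]
    {f : (ℕ → ℕ) → X} (hf : Continuous f) {c : ENNReal} (hc : c < μ (range f)) :
    ∃ K ⊆ range f, IsCompact K ∧ c ≤ μ K := by
  -- Continuity from below along increasing unions needs no measurability, so the coordinates can be
  -- bounded one at a time while the image keeps measure above `c`.
  have step : ∀ (k : ℕ) (U : Set (ℕ → ℕ)), ∃ m : ℕ,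
      c < μ (f '' U) → c < μ (f '' (U ∩ {z | z k ≤ m})) := by
    intro k U
    by_cases h : c < μ (f '' U)
    · have hU : f '' U = ⋃ m : ℕ, f '' (U ∩ {z | z k ≤ m}) := by
        rw [← image_iUnion, ← inter_iUnion]
        congr 1
        refine (inter_eq_left.2 fun z _ => mem_iUnion.2 ⟨z k, le_refl (z k)⟩).symm
      have hmono : Monotone fun m : ℕ => f '' (U ∩ {z | z k ≤ m}) := by
        intro a b hab
        refine image_mono (inter_subset_inter_right _ fun z hz => ?_)
        exact le_trans (show z k ≤ a from hz) hab
      rw [hU, hmono.measure_iUnion] at h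
      obtain ⟨m, hm⟩ := lt_iSup_iff.1 h
      exact ⟨m, fun _ => hm⟩
    · exact ⟨0, fun h' => absurd h' h⟩
  choose m hm using step
  let U : ℕ → Set (ℕ → ℕ) := fun k => Nat.rec univ (fun k V => V ∩ {z | z k ≤ m k V}) k
  have hU0 : U 0 = univ := rfl
  have hUs : ∀ k, U (k + 1) = U k ∩ {z | z k ≤ m k (U k)} := fun k => rfl
  have hcU : ∀ k, c < μ (f '' U k) := by
    intro k
    induction k with
    | zero => rwa [hU0, image_univ]
    | succ k ih => rw [hUs]; exact hm k _ ih
  set n : ℕ → ℕ := fun k => m k (U k) with hn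
  have hUmem : ∀ k z, z ∈ U k ↔ ∀ i < k, z i ≤ n i := by
    intro k
    induction k with
    | zero => intro z; simp [hU0]
    | succ k ih =>
      intro z
      rw [hUs]
      constructor
      · rintro ⟨h1, h2⟩ i hi
        rcases Nat.lt_succ_iff_lt_or_eq.1 hi with h | rfl
        · exact (ih z).1 h1 i h
        · exact h2
      · intro h
        exact ⟨(ih z).2 fun i hi => h i (hi.trans (Nat.lt_succ_self k)), h k (Nat.lt_succ_self k)⟩
  set K : Set (ℕ → ℕ) := univ.pi fun k => Iic (n k) with hK
  have hKc : IsCompact K := isCompact_univ_pi fun k => (finite_Iic (n k)).isCompact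
  refine ⟨f '' K, image_subset_range _ _, hKc.image hf, ?_⟩
  let := TopologicalSpace.upgradeIsCompletelyMetrizable X
  -- The sets `f '' U k` need not be measurable; their closures are, and in the limit they lose
  -- nothing, because they shrink into the compact image.
  have hsub : ⋂ k, closure (f '' U k) ⊆ f '' K := by
    intro y hy
    rw [mem_iInter] at hy
    have : ∀ k : ℕ, ∃ z ∈ U k, dist y (f z) < 1 / ((k : ℝ) + 1) := by
      intro k
      obtain ⟨w, ⟨z, hz, rfl⟩, hd⟩ := Metric.mem_closure_iff.1 (hy k) (1 / ((k : ℝ) + 1))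
        (by positivity)
      exact ⟨z, hz, hd⟩
    choose z hzU hzd using this
    -- The points `z k` lie outside `K` in general. Truncating them by `n` gives points of `K`, and
    -- each fixed coordinate of `z k` is eventually unaffected by the truncation.
    obtain ⟨w, hwK, φ, hφ, hlim⟩ := hKc.tendsto_subseq (x := fun k i => min (z k i) (n i))
      (fun k i _ => mem_Iic.2 (min_le_right _ _))
    refine ⟨w, hwK, ?_⟩
    have hzlim : Tendsto (fun k => z (φ k)) atTop (𝓝 w) := by
      rw [tendsto_pi_nhds] at hlim ⊢
      intro i
      refine (hlim i).congr' ?_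
      filter_upwards [eventually_gt_atTop i] with k hk
      exact min_eq_left ((hUmem _ _).1 (hzU (φ k)) i (hk.trans_le (hφ.id_le k)))
    have h1 : Tendsto (fun k => f (z (φ k))) atTop (𝓝 (f w)) := (hf.tendsto w).comp hzlim
    have h2 : Tendsto (fun k => f (z k)) atTop (𝓝 y) := by
      rw [tendsto_iff_dist_tendsto_zero]
      refine squeeze_zero (fun _ => dist_nonneg) (fun k => ?_)
        tendsto_one_div_add_atTop_nhds_zero_nat
      rw [dist_comm]
      exact (hzd k).le
    exact tendsto_nhds_unique h1 (h2.comp hφ.tendsto_atTop)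
  have hanti : Antitone fun k => closure (f '' U k) := by
    intro a b hab
    refine closure_mono (image_mono fun z hz => ?_)
    exact (hUmem _ _).2 fun i hi => (hUmem _ _).1 hz i (hi.trans_le hab)
  refine le_trans ?_ (measure_mono hsub)
  rw [hanti.measure_iInter (fun k => isClosed_closure.measurableSet.nullMeasurableSet)
    ⟨0, measure_ne_top _ _⟩]
  exact le_iInf fun k => (hcU k).le.trans (measure_mono subset_closure)

/-- Analytic sets are universally measurable. -/
theorem nullMeasurableSet_of_analyticSet {X : Type*} [TopologicalSpace X] [PolishSpace X]
    [MeasurableSpace X] [BorelSpace X] (μ : Measure X) [IsFiniteMeasure μ]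
    {s : Set X} (hs : AnalyticSet s) : NullMeasurableSet s μ := by
  rw [AnalyticSet] at hs
  rcases hs with rfl | ⟨f, hf, rfl⟩
  · exact MeasurableSet.empty.nullMeasurableSet
  rcases eq_or_ne (μ (range f)) 0 with h0 | h0
  · exact NullMeasurableSet.of_null h0
  obtain ⟨u, -, hu, hlim⟩ := exists_seq_strictMono_tendsto' (pos_iff_ne_zero.2 h0)
  choose K hKs hKc hKm using fun n => exists_isCompact_subset_range μ hf (hu n).2
  have hKmeas : MeasurableSet (⋃ n, K n) := MeasurableSet.iUnion fun n => (hKc n).measurableSet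
  refine hKmeas.nullMeasurableSet.congr
    (ae_eq_of_subset_of_measure_ge (iUnion_subset hKs) ?_ hKmeas.nullMeasurableSet
      (measure_ne_top _ _))
  exact le_of_tendsto' hlim fun n => (hKm n).trans (measure_mono (subset_iUnion K n))

theorem nullMeasurableSet_image {Z X : Type*} [MeasurableSpace Z] [StandardBorelSpace Z]
    [MeasurableSpace X] [StandardBorelSpace X] (μ : Measure X) [IsFiniteMeasure μ] {π : Z → X}
    (hπ : Measurable π) {s : Set Z} (hs : MeasurableSet s) : NullMeasurableSet (π '' s) μ := by
  let := upgradeStandardBorel X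
  exact nullMeasurableSet_of_analyticSet μ (hs.analyticSet_image hπ)

end AnalyticSets

/-! ### Lusin–Novikov up to null sets -/

section CountableToOne

/-- The sets whose fibres are closed, and whose complement is covered by countably many
measurable partial sections of `π`. -/
structure IsCofinalRemainder {Z X : Type*} [MeasurableSpace Z] [TopologicalSpace Z]
    (π : Z → X) (F : Set Z) : Prop where
  measurableSet : MeasurableSet F
  isClosed_fiber : ∀ x, IsClosed (F ∩ π ⁻¹' {x})
  exists_cover : ∃ 𝒢 : Set (Set Z), 𝒢.Countable ∧ (∀ G ∈ 𝒢, MeasurableSet G ∧ InjOn π G) ∧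
    Fᶜ ⊆ ⋃₀ 𝒢

/-- Stability under countable intersections allows a minimising sequence of remainders to be
replaced by a single remainder. This takes the place of the transfinite Cantor–Bendixson derivative.
-/
theorem IsCofinalRemainder.iInter {Z X ι : Type*} [Countable ι] [MeasurableSpace Z]
    [TopologicalSpace Z] {π : Z → X} (hπ : ∀ x, IsClosed (π ⁻¹' {x})) {F : ι → Set Z}
    (hF : ∀ i, IsCofinalRemainder π (F i)) : IsCofinalRemainder π (⋂ i, F i) := by
  refine ⟨MeasurableSet.iInter fun i => (hF i).measurableSet, fun x => ?_, ?_⟩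
  · have : (⋂ i, F i) ∩ π ⁻¹' {x} = (⋂ i, F i ∩ π ⁻¹' {x}) ∩ π ⁻¹' {x} := by
      ext z
      simp only [mem_inter_iff, mem_iInter]
      exact ⟨fun h => ⟨fun i => ⟨h.1 i, h.2⟩, h.2⟩, fun h => ⟨fun i => (h.1 i).1, h.2⟩⟩
    rw [this]
    exact (isClosed_iInter fun i => (hF i).isClosed_fiber x).inter (hπ x)
  · choose 𝒢 hc h hcov using fun i => (hF i).exists_cover
    refine ⟨⋃ i, 𝒢 i, countable_iUnion hc, fun G hG => ?_, ?_⟩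
    · obtain ⟨i, hi⟩ := mem_iUnion.1 hG
      exact h i G hi
    · rw [compl_iInter, sUnion_iUnion]
      exact iUnion_mono hcov

/-- The points of `X` over which `F` has exactly one point. -/
def singletonFibers {Z X : Type*} (π : Z → X) (F : Set Z) : Set X :=
  {x | ∃ z, F ∩ π ⁻¹' {x} = {z}}

theorem injOn_inter_preimage_singletonFibers {Z X : Type*} (π : Z → X) (F : Set Z) :
    InjOn π (F ∩ π ⁻¹' singletonFibers π F) := by
  rintro a ⟨haF, z, hz⟩ b ⟨hbF, -⟩ hab
  have ha : a ∈ F ∩ π ⁻¹' {π a} := ⟨haF, rfl⟩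
  have hb : b ∈ F ∩ π ⁻¹' {π a} := ⟨hbF, hab.symm⟩
  rw [hz] at ha hb
  exact (mem_singleton_iff.1 ha).trans (mem_singleton_iff.1 hb).symm

/-- Two distinct points of a fibre are separated by disjoint basic open sets, so having more than
one point is a countable union of intersections of analytic sets. -/
theorem nullMeasurableSet_singletonFibers {Z X : Type*} [TopologicalSpace Z] [PolishSpace Z]
    [MeasurableSpace Z] [BorelSpace Z] [MeasurableSpace X] [StandardBorelSpace X]
    (μ : Measure X) [IsFiniteMeasure μ] {π : Z → X} (hπ : Measurable π) {F : Set Z}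
    (hF : MeasurableSet F) : NullMeasurableSet (singletonFibers π F) μ := by
  obtain ⟨b, hbc, -, hb⟩ := TopologicalSpace.exists_countable_basis Z
  have hbm : ∀ u ∈ b, MeasurableSet u := fun u hu => (hb.isOpen hu).measurableSet
  have heq : singletonFibers π F = π '' F \ ⋃ u ∈ b, ⋃ v ∈ {v ∈ b | Disjoint u v},
      π '' (F ∩ u) ∩ π '' (F ∩ v) := by
    ext x
    simp only [mem_sdiff, mem_iUnion, not_exists]
    constructor
    · rintro ⟨z, hz⟩
      have hzm : z ∈ F ∩ π ⁻¹' {x} := by rw [hz]; rfl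
      refine ⟨⟨z, hzm.1, hzm.2⟩, ?_⟩
      rintro u - v ⟨-, huv⟩ ⟨⟨p, ⟨hpF, hpu⟩, hp⟩, ⟨q, ⟨hqF, hqv⟩, hq⟩⟩
      have h1 : p ∈ F ∩ π ⁻¹' {x} := ⟨hpF, hp⟩
      have h2 : q ∈ F ∩ π ⁻¹' {x} := ⟨hqF, hq⟩
      rw [hz, mem_singleton_iff] at h1 h2
      subst h1 h2
      exact disjoint_left.1 huv hpu hqv
    · rintro ⟨⟨z, hzF, rfl⟩, h⟩
      refine ⟨z, Subset.antisymm ?_ (singleton_subset_iff.2 ⟨hzF, rfl⟩)⟩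
      rintro w ⟨hwF, hw⟩
      by_contra hne
      obtain ⟨U, V, hU, hV, hwU, hzV, hUV⟩ := t2_separation (show w ≠ z from hne)
      obtain ⟨u, hu, hwu, huU⟩ := hb.exists_subset_of_mem_open hwU hU
      obtain ⟨v, hv, hzv, hvV⟩ := hb.exists_subset_of_mem_open hzV hV
      exact h u hu v ⟨hv, hUV.mono huU hvV⟩ ⟨⟨w, ⟨hwF, hwu⟩, hw⟩, ⟨z, ⟨hzF, hzv⟩, rfl⟩⟩
  rw [heq]
  refine (nullMeasurableSet_image μ hπ hF).diff
    (NullMeasurableSet.biUnion hbc fun u hu => NullMeasurableSet.biUnion (hbc.mono (sep_subset _ _))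
      fun v hv => ?_)
  exact (nullMeasurableSet_image μ hπ (hF.inter (hbm u hu))).inter
    (nullMeasurableSet_image μ hπ (hF.inter (hbm v hv.1)))

/-- Cantor–Bendixson: a nonempty countable closed set of a Polish space has an isolated point. -/
theorem exists_isolated_of_countable {Z : Type*} [TopologicalSpace Z] [PolishSpace Z] {C : Set Z}
    (hC : IsClosed C) (hne : C.Nonempty) (hcount : C.Countable) :
    ∃ z ∈ C, ∃ U, IsOpen U ∧ z ∈ U ∧ C ∩ U = {z} := by
  by_contra hcon
  push Not at hcon
  let := TopologicalSpace.upgradeIsCompletelyMetrizable Z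
  have hP : Perfect C := by
    refine ⟨hC, fun z hz => accPt_iff_nhds.2 fun U hU => ?_⟩
    obtain ⟨V, hVU, hV, hzV⟩ := mem_nhds_iff.1 hU
    by_contra h
    push Not at h
    refine hcon z hz V hV hzV (Subset.antisymm ?_ (singleton_subset_iff.2 ⟨hz, hzV⟩))
    exact fun w hw => h w ⟨hVU hw.2, hw.1⟩
  obtain ⟨f, hfC, -, hf⟩ := hP.exists_nat_bool_injection hne
  have h1 : (range f).Countable := hcount.mono hfC
  have h2 : Countable (ℕ → Bool) := by
    have := h1.to_subtype
    exact (Set.rangeFactorization_injective.2 hf).countable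
  refine (Cardinal.mk_le_aleph0_iff.2 h2).not_gt ?_
  rw [← Cardinal.power_def, Cardinal.mk_bool, Cardinal.mk_nat]
  exact Cardinal.cantor _

/-- A countable-to-one continuous map has, up to a null set of the base, a countable cover by
partial sections. -/
theorem exists_countable_injOn_cover_of_continuous {Z X : Type*} [TopologicalSpace Z]
    [PolishSpace Z] [MeasurableSpace Z] [BorelSpace Z] [MeasurableSpace X] [StandardBorelSpace X]
    (μ : Measure X) [IsFiniteMeasure μ] {π : Z → X} (hπ : Measurable π)
    (hcl : ∀ x, IsClosed (π ⁻¹' {x})) (hcount : ∀ x, (π ⁻¹' {x}).Countable) :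
    ∃ 𝒢 : Set (Set Z), 𝒢.Countable ∧ (∀ G ∈ 𝒢, MeasurableSet G ∧ InjOn π G) ∧
      μ (π '' (⋃₀ 𝒢)ᶜ) = 0 := by
  obtain ⟨b, hbc, -, hb⟩ := TopologicalSpace.exists_countable_basis Z
  have hbm : ∀ u ∈ b, MeasurableSet u := fun u hu => (hb.isOpen hu).measurableSet
  have huniv : IsCofinalRemainder π univ :=
    ⟨MeasurableSet.univ, fun x => by simpa using hcl x, ∅, countable_empty, by simp, by simp⟩
  -- For each basic open set `u`, the measure of the image of the part of the remainder in `u`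
  -- attains its infimum on an intersection of remainders; intersecting over `u` makes one `F`
  -- minimal for all `u` at once.
  have hmin : ∀ u : b, ∃ F : ℕ → Set Z, (∀ n, IsCofinalRemainder π (F n)) ∧
      ∀ F', IsCofinalRemainder π F' → μ (π '' ((⋂ n, F n) ∩ u)) ≤ μ (π '' (F' ∩ u)) := by
    intro u
    obtain ⟨s, -, hs, hmem⟩ := exists_seq_tendsto_sInf
      (S := (fun F => μ (π '' (F ∩ u))) '' {F | IsCofinalRemainder π F})
      ⟨_, univ, huniv, rfl⟩ (OrderBot.bddBelow _)
    choose F hF hFs using hmem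
    refine ⟨F, hF, fun F' hF' => ?_⟩
    refine (ge_of_tendsto' hs fun n => ?_).trans (sInf_le ⟨F', hF', rfl⟩)
    rw [← hFs n]
    exact measure_mono (image_mono (inter_subset_inter_left _ (iInter_subset _ _)))
  choose F₀ hF₀ hF₀min using hmin
  have : Countable b := hbc.to_subtype
  set F : Set Z := ⋂ u : b, ⋂ n, F₀ u n with hFdef
  have hF : IsCofinalRemainder π F :=
    IsCofinalRemainder.iInter hcl fun u => IsCofinalRemainder.iInter hcl (hF₀ u)
  have hFmin : ∀ u ∈ b, ∀ F', IsCofinalRemainder π F' → μ (π '' (F ∩ u)) ≤ μ (π '' (F' ∩ u)) := by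
    intro u hu F' hF'
    refine le_trans (measure_mono (image_mono (inter_subset_inter_left _ ?_)))
      (hF₀min ⟨u, hu⟩ F' hF')
    exact iInter_subset _ (⟨u, hu⟩ : b)
  have hsf : ∀ u : b, ∃ U ⊆ singletonFibers π (F ∩ u), MeasurableSet U ∧
      U =ᵐ[μ] singletonFibers π (F ∩ u) := fun u =>
    (nullMeasurableSet_singletonFibers μ hπ
      (hF.measurableSet.inter (hbm u u.2))).exists_measurable_subset_ae_eq
  choose U hUs hUm hUae using hsf
  have hGm : ∀ u : b, MeasurableSet ((u : Set Z) ∩ π ⁻¹' U u) := fun u =>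
    (hbm u u.2).inter (hπ (hUm u))
  -- Deleting the points that `F` has alone in `u` above `U u` again leaves a remainder: fibres lose
  -- only open parts, and the deleted points form countably many partial sections.
  have hF' : IsCofinalRemainder π (F \ ⋃ u : b, (u : Set Z) ∩ π ⁻¹' U u) := by
    refine ⟨hF.measurableSet.diff (MeasurableSet.iUnion hGm), fun x => ?_, ?_⟩
    · have : (F \ ⋃ u : b, (u : Set Z) ∩ π ⁻¹' U u) ∩ π ⁻¹' {x} =
          (F ∩ π ⁻¹' {x}) \ ⋃ u ∈ {u : b | x ∈ U u}, (u : Set Z) := by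
        ext z
        simp only [mem_inter_iff, mem_sdiff, mem_iUnion, mem_preimage, mem_singleton_iff,
          not_exists, not_and]
        constructor
        · rintro ⟨⟨h1, h2⟩, rfl⟩
          exact ⟨⟨h1, rfl⟩, fun u hu hzu => h2 u hzu hu⟩
        · rintro ⟨⟨h1, rfl⟩, h2⟩
          exact ⟨⟨h1, fun u hzu hu => h2 u hu hzu⟩, rfl⟩
      rw [this]
      exact (hF.isClosed_fiber x).sdiff (isOpen_biUnion fun u _ => hb.isOpen u.2)
    · obtain ⟨𝒢, h1, h2, h3⟩ := hF.exists_cover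
      refine ⟨𝒢 ∪ range fun u : b => F ∩ ((u : Set Z) ∩ π ⁻¹' U u),
        h1.union (countable_range _), ?_, ?_⟩
      · rintro G (hG | ⟨u, rfl⟩)
        · exact h2 G hG
        · refine ⟨hF.measurableSet.inter (hGm u),
            (injOn_inter_preimage_singletonFibers π (F ∩ u)).mono ?_⟩
          exact fun z hz => ⟨⟨hz.1, hz.2.1⟩, hUs u hz.2.2⟩
      · intro z hz
        by_cases hzF : z ∈ F
        · have : z ∈ ⋃ u : b, (u : Set Z) ∩ π ⁻¹' U u := by
            by_contra h
            exact hz ⟨hzF, h⟩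
          obtain ⟨u, hu⟩ := mem_iUnion.1 this
          exact ⟨_, Or.inr ⟨u, rfl⟩, hzF, hu⟩
        · obtain ⟨G, hG, hzG⟩ := h3 hzF
          exact ⟨G, Or.inl hG, hzG⟩
  -- The deletion removes `U u` from the image of `F ∩ u`, so minimality of `F` forces `U u` to be
  -- null.
  have hUnull : ∀ u : b, μ (singletonFibers π (F ∩ u)) = 0 := by
    intro u
    rw [← measure_congr (hUae u)]
    set F' := F \ ⋃ u : b, (u : Set Z) ∩ π ⁻¹' U u with hF'def
    have hsub : π '' (F' ∩ u) ⊆ π '' (F ∩ u) :=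
      image_mono (inter_subset_inter_left _ sdiff_subset)
    have hae := ae_eq_of_subset_of_measure_ge hsub (hFmin u u.2 F' hF')
      (nullMeasurableSet_image μ hπ (hF'.measurableSet.inter (hbm u u.2))) (measure_ne_top _ _)
    refine measure_mono_null ?_ (ae_le_set.1 hae.symm.le)
    intro x hx
    obtain ⟨z, hz⟩ := hUs u hx
    have hzm : z ∈ (F ∩ u) ∩ π ⁻¹' {x} := by rw [hz]; rfl
    refine ⟨⟨z, hzm.1, hzm.2⟩, ?_⟩
    rintro ⟨w, ⟨hwF', hwu⟩, rfl⟩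
    exact hwF'.2 (mem_iUnion.2 ⟨u, hwu, hx⟩)
  obtain ⟨𝒢, h1, h2, h3⟩ := hF.exists_cover
  refine ⟨𝒢, h1, h2, measure_mono_null ?_ (measure_iUnion_null hUnull)⟩
  rintro x ⟨z, hz, rfl⟩
  have hzF : z ∈ F := by
    by_contra h
    exact hz (h3 h)
  -- A nonempty fibre of `F` is closed and countable, so it has an isolated point; some basic `u`
  -- isolates it and puts `π z` in one of the null sets.
  obtain ⟨w, ⟨hwF, hw⟩, V, hV, hwV, hVs⟩ := exists_isolated_of_countable
    (hF.isClosed_fiber (π z)) ⟨z, hzF, rfl⟩ ((hcount (π z)).mono inter_subset_right)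
  obtain ⟨u, hu, hwu, huV⟩ := hb.exists_subset_of_mem_open hwV hV
  refine mem_iUnion.2 ⟨⟨u, hu⟩, w, Subset.antisymm ?_
    (singleton_subset_iff.2 ⟨⟨hwF, hwu⟩, hw⟩)⟩
  rintro p ⟨⟨hpF, hpu⟩, hp⟩
  rw [← hVs]
  exact ⟨⟨hpF, hp⟩, huV hpu⟩

/-- The **Lusin–Novikov theorem**, up to null sets: a countable-to-one Borel map between standard
Borel spaces has, up to a null set of the base, a countable cover by Borel partial sections. -/
theorem exists_countable_injOn_cover {Z X : Type*} [MeasurableSpace Z] [StandardBorelSpace Z]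
    [MeasurableSpace X] [StandardBorelSpace X] (μ : Measure X) [IsFiniteMeasure μ] {π : Z → X}
    (hπ : Measurable π) (hcount : ∀ x, (π ⁻¹' {x}).Countable) :
    ∃ G : ℕ → Set Z, (∀ n, MeasurableSet (G n)) ∧ (∀ n, InjOn π (G n)) ∧
      μ (π '' (⋃ n, G n)ᶜ) = 0 := by
  let := upgradeStandardBorel X
  obtain ⟨t, hbt, hpt⟩ := StandardBorelSpace.polish (α := Z)
  -- A finer Polish topology with the same Borel sets makes `π` continuous, so that its fibres are
  -- closed.
  obtain ⟨t', hle, hcont, hpt'⟩ := hπ.exists_continuous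
  have hbt' : @BorelSpace Z t' _ :=
    @BorelSpace.mk _ t' _ (hbt.measurable_eq.trans (borel_eq_borel_of_le hpt' hpt hle).symm)
  obtain ⟨𝒢, h1, h2, h3⟩ :=
    @exists_countable_injOn_cover_of_continuous Z X t' hpt' _ hbt' _ _ μ _ π hπ
      (fun x => isClosed_singleton.preimage hcont) hcount
  obtain ⟨G, hG⟩ := (h1.insert ∅).exists_eq_range (insert_nonempty _ _)
  have hmem : ∀ n, MeasurableSet (G n) ∧ InjOn π (G n) := by
    intro n
    have : G n ∈ insert ∅ 𝒢 := hG ▸ mem_range_self n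
    rcases this with h | h
    · rw [h]; exact ⟨MeasurableSet.empty, injOn_empty _⟩
    · exact h2 _ h
  refine ⟨G, fun n => (hmem n).1, fun n => (hmem n).2, ?_⟩
  rw [← sUnion_range, ← hG, sUnion_insert, empty_union]
  exact h3

end CountableToOne

end NonsingularRelation

namespace NonsingularRelation

/-! ### Fibrewise counting measures -/

section CountingMeasure

variable {Y X : Type*} [MeasurableSpace Y] [MeasurableSpace X]

/-- A countable measurable partition of `Γ`, up to a set with null image under `π`, into sets on
which `π` is injective. -/
structure IsSectionPartition (π : Y → X) (Γ : Set Y) (ν : Measure X) (P : ℕ → Set Y) : Prop where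
  measurable : Measurable π
  measurableSet : ∀ k, MeasurableSet (P k)
  subset : ∀ k, P k ⊆ Γ
  disjoint : Pairwise (Function.onFun Disjoint P)
  injOn : ∀ k, InjOn π (P k)
  null : ν (π '' (Γ \ ⋃ k, P k)) = 0

namespace IsSectionPartition

variable {π : Y → X} {Γ : Set Y} {ν : Measure X} {P : ℕ → Set Y}

theorem count_restrict_apply [StandardBorelSpace Y] (h : IsSectionPartition π Γ ν P)
    {W : Set Y} (hW : MeasurableSet W)
    (k : ℕ) (x : X) : (Measure.count.restrict (P k ∩ π ⁻¹' {x})) W =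
      (π '' (W ∩ P k)).indicator 1 x := by
  rw [Measure.restrict_apply hW]
  by_cases hx : x ∈ π '' (W ∩ P k)
  · obtain ⟨z, ⟨hzW, hzP⟩, rfl⟩ := hx
    have : W ∩ (P k ∩ π ⁻¹' {π z}) = {z} := by
      refine Subset.antisymm ?_ (singleton_subset_iff.2 ⟨hzW, hzP, rfl⟩)
      exact fun w hw => h.injOn k hw.2.1 hzP hw.2.2
    rw [this, Measure.count_singleton,
      indicator_of_mem (mem_image_of_mem π (show z ∈ W ∩ P k from ⟨hzW, hzP⟩))]
    rfl
  · have : W ∩ (P k ∩ π ⁻¹' {x}) = ∅ := by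
      refine eq_empty_of_forall_notMem fun w hw => hx ⟨w, ⟨hw.1, hw.2.1⟩, hw.2.2⟩
    rw [this, measure_empty, indicator_of_notMem hx]

variable [StandardBorelSpace X]

theorem measurableSet_image [StandardBorelSpace Y] (h : IsSectionPartition π Γ ν P)
    {W : Set Y} (hW : MeasurableSet W)
    (k : ℕ) : MeasurableSet (π '' (W ∩ P k)) :=
  (hW.inter (h.measurableSet k)).image_of_measurable_injOn h.measurable
    ((h.injOn k).mono inter_subset_right)

theorem measurable_sum [StandardBorelSpace Y] (h : IsSectionPartition π Γ ν P) :
    Measurable fun x => Measure.sum fun k => Measure.count.restrict (P k ∩ π ⁻¹' {x}) := by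
  refine Measure.measurable_of_measurable_coe _ fun W hW => ?_
  simp only [Measure.sum_apply _ hW, h.count_restrict_apply hW]
  exact Measurable.tsum fun k => measurable_one.indicator (h.measurableSet_image hW k)

/-- Evaluating a `bind` requires a.e. measurability of the kernel. Off a null set the kernel is a
sum of counting measures on sets with at most one point, for which measurability is clear. -/
theorem ae_eq_sum (h : IsSectionPartition π Γ ν P) :
    (fun x => Measure.count.restrict {p | p ∈ Γ ∧ π p = x}) =ᵐ[ν]
      fun x => Measure.sum fun k => Measure.count.restrict (P k ∩ π ⁻¹' {x}) := by
  filter_upwards [measure_eq_zero_iff_ae_notMem.1 h.null] with x hx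
  have : {p | p ∈ Γ ∧ π p = x} = ⋃ k, P k ∩ π ⁻¹' {x} := by
    rw [← iUnion_inter]
    ext p
    constructor
    · rintro ⟨hp, rfl⟩
      refine ⟨?_, rfl⟩
      by_contra hP
      exact hx ⟨p, ⟨hp, hP⟩, rfl⟩
    · rintro ⟨hp, hpx⟩
      obtain ⟨k, hk⟩ := mem_iUnion.1 hp
      exact ⟨h.subset k hk, hpx⟩
  rw [this]
  exact Measure.restrict_iUnion
    (fun i j hij => (h.disjoint hij).mono inter_subset_left inter_subset_left)
    fun k => (h.measurableSet k).inter (h.measurable (measurableSet_singleton x))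

theorem bind_apply [StandardBorelSpace Y] (h : IsSectionPartition π Γ ν P)
    {W : Set Y} (hW : MeasurableSet W) :
    (ν.bind fun x => Measure.count.restrict {p | p ∈ Γ ∧ π p = x}) W =
      ∑' k, ν (π '' (W ∩ P k)) := by
  rw [Measure.bind_congr_right h.ae_eq_sum, Measure.bind_apply hW h.measurable_sum.aemeasurable]
  simp only [Measure.sum_apply _ hW, h.count_restrict_apply hW]
  rw [lintegral_tsum fun k =>
    (measurable_one.indicator (h.measurableSet_image hW k)).aemeasurable]
  exact tsum_congr fun k => lintegral_indicator_one (h.measurableSet_image hW k)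

/-- Injectivity on `W` makes the images of the pieces disjoint, so the sum in `bind_apply` collapses
to a single measure. -/
theorem bind_apply_of_injOn [StandardBorelSpace Y] (h : IsSectionPartition π Γ ν P)
    {W : Set Y} (hW : MeasurableSet W)
    (hWΓ : W ⊆ Γ) (hinj : InjOn π W) :
    (ν.bind fun x => Measure.count.restrict {p | p ∈ Γ ∧ π p = x}) W = ν (π '' W) := by
  rw [h.bind_apply hW, ← measure_iUnion _ (h.measurableSet_image hW)]
  · refine le_antisymm (measure_mono (iUnion_subset fun k => image_mono inter_subset_left)) ?_
    have hsub : π '' W ⊆ (⋃ k, π '' (W ∩ P k)) ∪ π '' (Γ \ ⋃ k, P k) := by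
      rintro _ ⟨z, hz, rfl⟩
      by_cases hzP : z ∈ ⋃ k, P k
      · obtain ⟨k, hk⟩ := mem_iUnion.1 hzP
        exact Or.inl (mem_iUnion.2 ⟨k, z, ⟨hz, hk⟩, rfl⟩)
      · exact Or.inr ⟨z, ⟨hWΓ hz, hzP⟩, rfl⟩
    refine (measure_mono hsub).trans ((measure_union_le _ _).trans ?_)
    rw [h.null, add_zero]
  · intro i j hij
    refine disjoint_left.2 ?_
    rintro _ ⟨z, ⟨hzW, hzi⟩, rfl⟩ ⟨w, ⟨hwW, hwj⟩, hwz⟩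
    obtain rfl := hinj hwW hzW hwz
    exact disjoint_left.1 (h.disjoint hij) hzi hwj

theorem sigmaFinite_bind [StandardBorelSpace Y] [SigmaFinite ν] (h : IsSectionPartition π Γ ν P) :
    SigmaFinite (ν.bind fun x => Measure.count.restrict {p | p ∈ Γ ∧ π p = x}) := by
  refine Measure.sigmaFinite_of_countable (S := insert (⋃ k, P k)ᶜ
    (range fun i : ℕ × ℕ => P i.1 ∩ π ⁻¹' spanningSets ν i.2))
    ((countable_range _).insert _) ?_ ?_
  · rintro _ (rfl | ⟨⟨k, j⟩, rfl⟩)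
    · rw [h.bind_apply (MeasurableSet.iUnion h.measurableSet).compl]
      have : ∀ k, (⋃ k, P k)ᶜ ∩ P k = ∅ := fun k =>
        eq_empty_of_forall_notMem fun z hz => hz.1 (mem_iUnion.2 ⟨k, hz.2⟩)
      simp only [this, image_empty, measure_empty, tsum_zero, ENNReal.zero_lt_top]
    · dsimp only
      rw [h.bind_apply_of_injOn
        ((h.measurableSet k).inter (h.measurable (measurableSet_spanningSets ν j)))
        (inter_subset_left.trans (h.subset k)) ((h.injOn k).mono inter_subset_left)]
      refine (measure_mono ?_).trans_lt (measure_spanningSets_lt_top ν j)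
      rintro _ ⟨z, hz, rfl⟩
      exact hz.2
  · refine eq_univ_of_forall fun z => ?_
    by_cases hz : z ∈ ⋃ k, P k
    · obtain ⟨k, hk⟩ := mem_iUnion.1 hz
      obtain ⟨j, hj⟩ := mem_iUnion.1 ((iUnion_spanningSets ν).symm ▸ mem_univ (π z))
      exact ⟨_, Or.inr ⟨(k, j), rfl⟩, hk, hj⟩
    · exact ⟨_, Or.inl rfl, hz⟩

end IsSectionPartition

end CountingMeasure

/-! ### Bisections of the relation -/

theorem image_fst_preimage_swap {X : Type*} (W : Set (X × X)) :
    Prod.fst '' (Prod.swap ⁻¹' W) = Prod.snd '' W := by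
  rw [← image_swap_eq_preimage_swap, image_image]
  rfl

theorem image_snd_preimage_swap {X : Type*} (W : Set (X × X)) :
    Prod.snd '' (Prod.swap ⁻¹' W) = Prod.fst '' W := by
  rw [← image_swap_eq_preimage_swap, image_image]
  rfl

variable {X : Type*} [MeasurableSpace X]

/-- Measurable subsets of `R` that are graphs of injective partial maps. -/
structure IsBisection (R : Setoid X) (W : Set (X × X)) : Prop where
  measurableSet : MeasurableSet W
  subset_graph : W ⊆ graph R
  injOn_fst : InjOn Prod.fst W
  injOn_snd : InjOn Prod.snd W

namespace IsBisection

variable {R : Setoid X} {W V : Set (X × X)}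

theorem mono (hW : IsBisection R W) (hV : MeasurableSet V) (hVW : V ⊆ W) : IsBisection R V :=
  ⟨hV, hVW.trans hW.subset_graph, hW.injOn_fst.mono hVW, hW.injOn_snd.mono hVW⟩

theorem swap (hW : IsBisection R W) : IsBisection R (Prod.swap ⁻¹' W) := by
  refine ⟨measurable_swap hW.measurableSet, fun p hp => ?_, fun p hp q hq h => ?_,
    fun p hp q hq h => ?_⟩
  · exact R.symm (hW.subset_graph hp)
  · exact Prod.swap_injective (hW.injOn_snd hp hq h)
  · exact Prod.swap_injective (hW.injOn_fst hp hq h)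

theorem measurableSet_image_fst [StandardBorelSpace X] (hW : IsBisection R W) :
    MeasurableSet (Prod.fst '' W) :=
  hW.measurableSet.image_of_measurable_injOn measurable_fst hW.injOn_fst

theorem measurableSet_image_snd [StandardBorelSpace X] (hW : IsBisection R W) :
    MeasurableSet (Prod.snd '' W) :=
  hW.measurableSet.image_of_measurable_injOn measurable_snd hW.injOn_snd

end IsBisection

/-- For a nonsingular relation, the two projections of a subset of the relation are null at the
same time. -/
theorem IsNonsingular.null_image_iff {R : Setoid X} {μ : Measure X} (hR : IsNonsingular R μ)
    {V : Set (X × X)} (hV : V ⊆ graph R) : μ (Prod.fst '' V) = 0 ↔ μ (Prod.snd '' V) = 0 := by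
  constructor
  · refine fun h => measure_mono_null ?_ (hR.saturation_null _ h)
    rintro _ ⟨p, hp, rfl⟩
    exact ⟨p.1, ⟨p, hp, rfl⟩, hV hp⟩
  · refine fun h => measure_mono_null ?_ (hR.saturation_null _ h)
    rintro _ ⟨p, hp, rfl⟩
    exact ⟨p.2, ⟨p, hp, rfl⟩, R.symm (hV hp)⟩

/-- A countable partition of `R` into bisections, up to null sets. -/
structure IsBisectionPartition (R : Setoid X) (μ : Measure X) (P : ℕ → Set (X × X)) : Prop where
  isBisection : ∀ k, IsBisection R (P k)
  disjoint : Pairwise (Function.onFun Disjoint P)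
  null_fst : μ (Prod.fst '' (graph R \ ⋃ k, P k)) = 0
  null_snd : μ (Prod.snd '' (graph R \ ⋃ k, P k)) = 0

/-- Sections `H n` of the first coordinate cover $R$. Since $R$ is symmetric, their flips are
sections of the second coordinate and cover $R$ too, so the sets `H n ∩ Prod.swap ⁻¹' H m` are
bisections covering $R$ up to null sets. -/
theorem IsNonsingular.exists_isBisectionPartition [StandardBorelSpace X] {R : Setoid X}
    {μ : Measure X} [IsFiniteMeasure μ] (hR : IsNonsingular R μ) :
    ∃ P, IsBisectionPartition R μ P := by
  have := hR.measurableSet_graph.standardBorel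
  obtain ⟨G, hGm, hGi, hG0⟩ := exists_countable_injOn_cover (Z := graph R) μ
    (π := fun p => p.1.1) (by fun_prop) (fun x => by
      refine MapsTo.countable_of_injOn (t := {y | R x y}) (f := fun p => p.1.2) ?_ ?_
        (hR.countable_class x)
      · rintro ⟨p, hp⟩ rfl
        exact hp
      · rintro ⟨p, hp⟩ rfl ⟨q, hq⟩ hq' h
        exact Subtype.ext (Prod.ext hq'.symm h))
  set H : ℕ → Set (X × X) := fun n => Subtype.val '' G n with hH
  have hHm : ∀ n, MeasurableSet (H n) := fun n =>
    (MeasurableEmbedding.subtype_coe hR.measurableSet_graph).measurableSet_image.2 (hGm n)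
  have hHs : ∀ n, H n ⊆ graph R := fun n => by rintro _ ⟨p, -, rfl⟩; exact p.2
  have hHi : ∀ n, InjOn Prod.fst (H n) := by
    rintro n _ ⟨p, hp, rfl⟩ _ ⟨q, hq, rfl⟩ h
    rw [hGi n hp hq h]
  have hH0 : μ (Prod.fst '' (graph R \ ⋃ n, H n)) = 0 := by
    refine measure_mono_null ?_ hG0
    rintro _ ⟨p, ⟨hp, hpH⟩, rfl⟩
    refine ⟨⟨p, hp⟩, fun h => hpH ?_, rfl⟩
    obtain ⟨n, hn⟩ := mem_iUnion.1 h
    exact mem_iUnion.2 ⟨n, _, hn, rfl⟩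
  set Q : ℕ → Set (X × X) := fun i => H i.unpair.1 ∩ Prod.swap ⁻¹' H i.unpair.2 with hQ
  have hQb : ∀ i, IsBisection R (Q i) := by
    intro i
    refine ⟨(hHm _).inter (measurable_swap (hHm _)), inter_subset_left.trans (hHs _),
      (hHi _).mono inter_subset_left, ?_⟩
    rintro p ⟨-, hp⟩ q ⟨-, hq⟩ h
    exact Prod.swap_injective (hHi _ hp hq h)
  have hdisj : ∀ i, disjointed Q i ⊆ Q i := disjointed_subset Q
  have hnull : μ (Prod.fst '' (graph R \ ⋃ k, disjointed Q k)) = 0 := by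
    rw [iUnion_disjointed]
    refine measure_mono_null ?_ (measure_union_null hH0 (hR.saturation_null _ hH0))
    rintro _ ⟨p, ⟨hp, hpQ⟩, rfl⟩
    by_cases h1 : p ∈ ⋃ n, H n
    · by_cases h2 : p.swap ∈ ⋃ n, H n
      · obtain ⟨n, hn⟩ := mem_iUnion.1 h1
        obtain ⟨m, hm⟩ := mem_iUnion.1 h2
        refine absurd (mem_iUnion.2 ⟨Nat.pair n m, ?_⟩) hpQ
        simp only [hQ, Nat.unpair_pair]
        exact ⟨hn, hm⟩
      · exact Or.inr ⟨p.2, ⟨p.swap, ⟨R.symm hp, h2⟩, rfl⟩, R.symm hp⟩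
    · exact Or.inl ⟨p, ⟨hp, h1⟩, rfl⟩
  refine ⟨disjointed Q, fun k => (hQb k).mono
    (MeasurableSet.disjointed (fun i => (hQb i).measurableSet) k) (hdisj k),
    disjoint_disjointed Q, hnull, (hR.null_image_iff sdiff_subset).1 hnull⟩

/-! ### The modulus and Radon–Nikodym ratios -/

section Modulus

variable {R : Setoid X} {μ ν : Measure X} {P : ℕ → Set (X × X)}

theorem IsBisectionPartition.fst (hP : IsBisectionPartition R μ P) (hν : ν ≪ μ) :
    IsSectionPartition Prod.fst (graph R) ν P :=
  ⟨measurable_fst, fun k => (hP.isBisection k).measurableSet,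
    fun k => (hP.isBisection k).subset_graph, hP.disjoint,
    fun k => (hP.isBisection k).injOn_fst, hν hP.null_fst⟩

theorem IsBisectionPartition.snd (hP : IsBisectionPartition R μ P) (hν : ν ≪ μ) :
    IsSectionPartition Prod.snd (graph R) ν P :=
  ⟨measurable_snd, fun k => (hP.isBisection k).measurableSet,
    fun k => (hP.isBisection k).subset_graph, hP.disjoint,
    fun k => (hP.isBisection k).injOn_snd, hν hP.null_snd⟩

theorem IsNonsingular.of_measureClass (hR : IsNonsingular R μ) (hν : ν ∈ measureClass μ) :
    IsNonsingular R ν :=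
  ⟨hR.measurableSet_graph, hR.countable_class, fun N hN =>
    hν.2.1 (hR.saturation_null N (hν.2.2 hN))⟩

theorem measurable_modulus (R : Setoid X) (ν : Measure X) : Measurable (modulus R ν) :=
  (Measure.measurable_rnDeriv _ _).ennreal_toReal

variable [StandardBorelSpace X]

theorem IsBisection.leftMeasure_apply (hP : IsBisectionPartition R μ P) (hν : ν ≪ μ)
    {W : Set (X × X)} (hW : IsBisection R W) : leftMeasure R ν W = ν (Prod.fst '' W) :=
  (hP.fst hν).bind_apply_of_injOn hW.measurableSet hW.subset_graph hW.injOn_fst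

theorem IsBisection.rightMeasure_apply (hP : IsBisectionPartition R μ P) (hν : ν ≪ μ)
    {W : Set (X × X)} (hW : IsBisection R W) : rightMeasure R ν W = ν (Prod.snd '' W) :=
  (hP.snd hν).bind_apply_of_injOn hW.measurableSet hW.subset_graph hW.injOn_snd

/-- On each piece of the partition this is the fact that a nonsingular relation has simultaneously
null projections. -/
theorem leftMeasure_null_iff (hR : IsNonsingular R μ) (hP : IsBisectionPartition R μ P)
    (hν : ν ∈ measureClass μ) {W : Set (X × X)} (hW : MeasurableSet W) :
    leftMeasure R ν W = 0 ↔ rightMeasure R ν W = 0 := by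
  have h1 : leftMeasure R ν W = _ := (hP.fst hν.2.1).bind_apply hW
  have h2 : rightMeasure R ν W = _ := (hP.snd hν.2.1).bind_apply hW
  rw [h1, h2, ENNReal.tsum_eq_zero, ENNReal.tsum_eq_zero]
  exact forall_congr' fun k => (hR.of_measureClass hν).null_image_iff
    (inter_subset_right.trans (hP.isBisection k).subset_graph)

theorem sigmaFinite_leftMeasure (hP : IsBisectionPartition R μ P) (hν : ν ∈ measureClass μ) :
    SigmaFinite (leftMeasure R ν) :=
  have := hν.1
  (hP.fst hν.2.1).sigmaFinite_bind

theorem sigmaFinite_rightMeasure (hP : IsBisectionPartition R μ P) (hν : ν ∈ measureClass μ) :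
    SigmaFinite (rightMeasure R ν) :=
  have := hν.1
  (hP.snd hν.2.1).sigmaFinite_bind

theorem leftMeasure_eq_setLIntegral (hR : IsNonsingular R μ) (hP : IsBisectionPartition R μ P)
    (hν : ν ∈ measureClass μ) (W : Set (X × X)) :
    leftMeasure R ν W = ∫⁻ p in W, ENNReal.ofReal (modulus R ν p) ∂(rightMeasure R ν) := by
  have := sigmaFinite_leftMeasure hP hν
  have := sigmaFinite_rightMeasure hP hν
  have hac : leftMeasure R ν ≪ rightMeasure R ν := by
    refine Measure.AbsolutelyContinuous.mk fun s hs h => ?_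
    exact (leftMeasure_null_iff hR hP hν hs).2 h
  rw [← Measure.setLIntegral_rnDeriv hac W]
  refine lintegral_congr_ae (ae_restrict_of_ae ?_)
  filter_upwards [Measure.rnDeriv_lt_top (leftMeasure R ν) (rightMeasure R ν)] with p hp
  exact (ENNReal.ofReal_toReal hp.ne).symm

theorem ae_modulus_pos (hR : IsNonsingular R μ) (hP : IsBisectionPartition R μ P)
    (hν : ν ∈ measureClass μ) : ∀ᵐ p ∂(rightMeasure R ν), 0 < modulus R ν p := by
  have hm : MeasurableSet {p | modulus R ν p ≤ 0} :=
    measurableSet_le (measurable_modulus R ν) measurable_const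
  have h0 : rightMeasure R ν {p | modulus R ν p ≤ 0} = 0 := by
    rw [← leftMeasure_null_iff hR hP hν hm, leftMeasure_eq_setLIntegral hR hP hν,
      setLIntegral_congr_fun (g := 0) hm fun p hp => ENNReal.ofReal_of_nonpos hp]
    simp
  rw [ae_iff]
  simpa using h0

/-- The partial isomorphism with graph `W` changes the measure by a factor between `a`
and `b`. -/
def HasRatio (ν₁ ν₂ : Measure X) (a b : ENNReal) (W : Set (X × X)) : Prop :=
  ∀ V ⊆ W, MeasurableSet V → a * ν₁ (Prod.fst '' V) ≤ ν₂ (Prod.snd '' V) ∧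
    ν₂ (Prod.snd '' V) ≤ b * ν₁ (Prod.fst '' V)

/-- The swap is a matter of orientation: the modulus is $d\nu_\ell/d\nu_r$, which compares first
coordinates to second, while `HasRatio` compares target to source. -/
theorem IsBisection.hasRatio_swap_of_modulus (hR : IsNonsingular R μ)
    (hP : IsBisectionPartition R μ P) (hν : ν ∈ measureClass μ) {W : Set (X × X)}
    (hW : IsBisection R W) {c d : ℝ} (hcd : ∀ p ∈ W, c ≤ modulus R ν p ∧ modulus R ν p ≤ d) :
    HasRatio ν ν (ENNReal.ofReal c) (ENNReal.ofReal d) (Prod.swap ⁻¹' W) := by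
  intro V hVW hV
  have hV' : IsBisection R (Prod.swap ⁻¹' V) := (hW.swap.mono hV hVW).swap
  have hVW' : ∀ p ∈ Prod.swap ⁻¹' V, c ≤ modulus R ν p ∧ modulus R ν p ≤ d :=
    fun p hp => hcd p (by simpa using hVW hp)
  rw [← image_snd_preimage_swap V, ← image_fst_preimage_swap V,
    ← hV'.leftMeasure_apply hP hν.2.1, ← hV'.rightMeasure_apply hP hν.2.1,
    leftMeasure_eq_setLIntegral hR hP hν, ← setLIntegral_const,
    ← setLIntegral_const]
  exact ⟨setLIntegral_mono' hV'.measurableSet fun p hp =>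
      ENNReal.ofReal_le_ofReal (hVW' p hp).1,
    setLIntegral_mono' hV'.measurableSet fun p hp => ENNReal.ofReal_le_ofReal (hVW' p hp).2⟩

theorem exists_rightMeasure_ne_zero (hP : IsBisectionPartition R μ P) (hν : ν ≪ μ)
    {W : Set (X × X)} (hW : MeasurableSet W) (h : rightMeasure R ν W ≠ 0) :
    ∃ k, ν (Prod.snd '' (W ∩ P k)) ≠ 0 := by
  have h2 : rightMeasure R ν W = _ := (hP.snd hν).bind_apply hW
  rw [h2, Ne, ENNReal.tsum_eq_zero] at h
  push Not at h
  exact h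

end Modulus

end NonsingularRelation

namespace NonsingularRelation

/-! ### Composition of bisections -/

variable {X : Type*} [MeasurableSpace X]

/-- The composition of two relations: first `P`, then `Q`. -/
def compRel {X : Type*} (P Q : Set (X × X)) : Set (X × X) :=
  {p | ∃ y, (p.1, y) ∈ P ∧ (y, p.2) ∈ Q}

theorem HasRatio.mono {ν₁ ν₂ : Measure X} {a b : ENNReal} {V W : Set (X × X)}
    (h : HasRatio ν₁ ν₂ a b W) (hVW : V ⊆ W) : HasRatio ν₁ ν₂ a b V :=
  fun U hU hUm => h U (hU.trans hVW) hUm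

theorem HasRatio.weaken {ν₁ ν₂ : Measure X} {a b a' b' : ENNReal} {W : Set (X × X)}
    (h : HasRatio ν₁ ν₂ a b W) (ha : a' ≤ a) (hb : b ≤ b') : HasRatio ν₁ ν₂ a' b' W :=
  fun U hU hUm => ⟨(by gcongr : a' * _ ≤ a * _).trans (h U hU hUm).1,
    (h U hU hUm).2.trans (by gcongr)⟩

theorem HasRatio.swap_of_one {ν₁ ν₂ : Measure X} {W : Set (X × X)} (h : HasRatio ν₁ ν₂ 1 1 W) :
    HasRatio ν₂ ν₁ 1 1 (Prod.swap ⁻¹' W) := by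
  intro V hV hVm
  have := h (Prod.swap ⁻¹' V) (fun p hp => by simpa using hV hp) (measurable_swap hVm)
  rw [image_fst_preimage_swap, image_snd_preimage_swap, one_mul] at this
  rw [one_mul]
  exact ⟨this.2, this.1⟩

section Composition

variable [StandardBorelSpace X] {R : Setoid X} {P Q : Set (X × X)}

theorem IsBisection.comp (hP : IsBisection R P) (hQ : IsBisection R Q) :
    IsBisection R (compRel P Q) := by
  refine ⟨?_, ?_, ?_, ?_⟩
  · set T : Set ((X × X) × (X × X)) := (P ×ˢ Q) ∩ {q | q.1.2 = q.2.1} with hT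
    have hTm : MeasurableSet T :=
      (hP.measurableSet.prod hQ.measurableSet).inter
        (measurableSet_eq_fun (by fun_prop) (by fun_prop))
    have heq : compRel P Q = (fun q : (X × X) × (X × X) => (q.1.1, q.2.2)) '' T := by
      ext p
      constructor
      · rintro ⟨y, h1, h2⟩
        exact ⟨((p.1, y), (y, p.2)), ⟨⟨h1, h2⟩, rfl⟩, rfl⟩
      · rintro ⟨⟨⟨a, b⟩, ⟨c, d⟩⟩, ⟨⟨h1, h2⟩, h3⟩, rfl⟩
        obtain rfl : b = c := h3
        exact ⟨b, h1, h2⟩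
    rw [heq]
    refine hTm.image_of_measurable_injOn (by fun_prop) ?_
    rintro ⟨p, q⟩ ⟨⟨hp, hq⟩, -⟩ ⟨p', q'⟩ ⟨⟨hp', hq'⟩, -⟩ h
    obtain ⟨h1, h2⟩ := Prod.ext_iff.1 h
    exact Prod.ext (hP.injOn_fst hp hp' h1) (hQ.injOn_snd hq hq' h2)
  · rintro p ⟨y, h1, h2⟩
    have h1' : R p.1 y := hP.subset_graph h1
    have h2' : R y p.2 := hQ.subset_graph h2
    exact R.trans h1' h2'
  · rintro ⟨a, b⟩ ⟨y, h1, h2⟩ ⟨a', b'⟩ ⟨y', h1', h2'⟩ h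
    obtain rfl : a = a' := h
    obtain rfl : y = y' := congrArg Prod.snd (hP.injOn_fst h1 h1' rfl)
    exact Prod.ext rfl (congrArg Prod.snd (hQ.injOn_fst h2 h2' rfl) :)
  · rintro ⟨a, b⟩ ⟨y, h1, h2⟩ ⟨a', b'⟩ ⟨y', h1', h2'⟩ h
    obtain rfl : b = b' := h
    obtain rfl : y = y' := congrArg Prod.fst (hQ.injOn_snd h2 h2' rfl)
    exact Prod.ext (congrArg Prod.fst (hP.injOn_snd h1 h1' rfl) :) rfl

/-- A part `V` of the composite factors through the part of `P` with the same sources and the part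
of `Q` with the same targets; these meet in a common middle set (`e2`), where the two estimates are
chained. -/
theorem HasRatio.comp (hP : IsBisection R P) (hQ : IsBisection R Q) {ν₁ ν₂ ν₃ : Measure X}
    {a b a' b' : ENNReal} (h : HasRatio ν₁ ν₂ a b P) (h' : HasRatio ν₂ ν₃ a' b' Q) :
    HasRatio ν₁ ν₃ (a' * a) (b' * b) (compRel P Q) := by
  intro V hV hVm
  have hVb := (hP.comp hQ).mono hVm hV
  have e1 : Prod.fst '' (P ∩ Prod.fst ⁻¹' (Prod.fst '' V)) = Prod.fst '' V := by
    refine Subset.antisymm (by rintro _ ⟨p, hp, rfl⟩; exact hp.2) ?_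
    rintro _ ⟨p, hp, rfl⟩
    obtain ⟨y, h1, h2⟩ := hV hp
    exact ⟨(p.1, y), ⟨h1, p, hp, rfl⟩, rfl⟩
  have e3 : Prod.snd '' (Q ∩ Prod.snd ⁻¹' (Prod.snd '' V)) = Prod.snd '' V := by
    refine Subset.antisymm (by rintro _ ⟨p, hp, rfl⟩; exact hp.2) ?_
    rintro _ ⟨p, hp, rfl⟩
    obtain ⟨y, h1, h2⟩ := hV hp
    exact ⟨(y, p.2), ⟨h2, p, hp, rfl⟩, rfl⟩
  have e2 : Prod.snd '' (P ∩ Prod.fst ⁻¹' (Prod.fst '' V)) =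
      Prod.fst '' (Q ∩ Prod.snd ⁻¹' (Prod.snd '' V)) := by
    refine Subset.antisymm ?_ ?_
    · rintro _ ⟨⟨x, y⟩, ⟨hp, ⟨x', z⟩, hxz, hx⟩, rfl⟩
      obtain rfl : x' = x := hx
      obtain ⟨y', h1, h2⟩ := hV hxz
      obtain rfl : y = y' := congrArg Prod.snd (hP.injOn_fst hp h1 rfl)
      exact ⟨(y, z), ⟨h2, _, hxz, rfl⟩, rfl⟩
    · rintro _ ⟨⟨y, z⟩, ⟨hq, ⟨x, z'⟩, hxz, hz⟩, rfl⟩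
      obtain rfl : z' = z := hz
      obtain ⟨y', h1, h2⟩ := hV hxz
      obtain rfl : y = y' := congrArg Prod.fst (hQ.injOn_snd hq h2 rfl)
      exact ⟨(x, y), ⟨h1, _, hxz, rfl⟩, rfl⟩
  obtain ⟨k1, k2⟩ := h _ inter_subset_left
    (hP.measurableSet.inter (measurable_fst hVb.measurableSet_image_fst))
  obtain ⟨k3, k4⟩ := h' _ inter_subset_left
    (hQ.measurableSet.inter (measurable_snd hVb.measurableSet_image_snd))
  rw [e1, e2] at k1 k2
  rw [e3] at k3 k4
  rw [mul_assoc, mul_assoc]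
  exact ⟨(mul_le_mul_right k1 a').trans k3, k4.trans (mul_le_mul_right k2 b')⟩

end Composition

/-! ### Ergodicity and localisation of $S(R)$ -/

section Transport

variable [StandardBorelSpace X] {R : Setoid X} {μ : Measure X} [IsFiniteMeasure μ]

/-- The saturation of `A` is analytic, hence null measurable, so its invariant indicator is a.e.
constant; the constant is 1 because `A` is nonnull. -/
theorem IsErgodic.ae_exists_rel (hErg : IsErgodic R μ) (hR : IsNonsingular R μ) {A : Set X}
    (hA : MeasurableSet A) (hA0 : μ A ≠ 0) : ∀ᵐ x ∂μ, ∃ y ∈ A, R x y := by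
  set S : Set X := {x | ∃ y ∈ A, R x y} with hS
  have hSm : NullMeasurableSet S μ := by
    have : S = Prod.fst '' (graph R ∩ Prod.snd ⁻¹' A) := by
      ext x
      constructor
      · rintro ⟨y, hy, hxy⟩; exact ⟨(x, y), ⟨hxy, hy⟩, rfl⟩
      · rintro ⟨p, ⟨hp, hpA⟩, rfl⟩; exact ⟨p.2, hpA, hp⟩
    rw [this]
    exact nullMeasurableSet_image μ measurable_fst
      (hR.measurableSet_graph.inter (measurable_snd hA))
  have hinv : ∀ x y, R x y → (x ∈ S ↔ y ∈ S) := fun x y hxy =>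
    ⟨fun ⟨z, hz, hxz⟩ => ⟨z, hz, R.trans (R.symm hxy) hxz⟩,
      fun ⟨z, hz, hyz⟩ => ⟨z, hz, R.trans hxy hyz⟩⟩
  obtain ⟨c, hc⟩ := hErg (S.indicator fun _ => 1)
    (memLp_top_of_bound (aestronglyMeasurable_const.indicator₀ hSm) 1 (ae_of_all _ fun x => by
      by_cases hx : x ∈ S <;> simp [hx]))
    (ae_of_all _ fun x y hxy => by
      by_cases hx : x ∈ S
      · simp [hx, (hinv x y hxy).1 hx]
      · have hy : y ∉ S := fun h => hx ((hinv x y hxy).2 h)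
        simp [hx, hy])
  obtain ⟨x, hxA, hx⟩ : ∃ x ∈ A, S.indicator (fun _ => (1 : ℂ)) x = c := by
    by_contra h
    push Not at h
    exact hA0 (measure_mono_null (fun x hx => h x hx) (ae_iff.1 hc))
  have hxS : x ∈ S := ⟨x, hxA, R.refl x⟩
  rw [indicator_of_mem hxS] at hx
  filter_upwards [hc] with z hz
  by_contra hzS
  rw [indicator_of_notMem (show z ∉ S from hzS), ← hx] at hz
  exact zero_ne_one hz

/-- For an ergodic relation, there is a measurable map with values in `A` whose graph is contained
in the relation. -/
theorem IsErgodic.exists_graph_into (hErg : IsErgodic R μ) (hR : IsNonsingular R μ)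
    {P : ℕ → Set (X × X)} (hP : IsBisectionPartition R μ P) {A : Set X} (hA : MeasurableSet A)
    (hA0 : μ A ≠ 0) : ∃ Q ⊆ ⋃ k, P k, MeasurableSet Q ∧ InjOn Prod.fst Q ∧
      Q ⊆ Prod.snd ⁻¹' A ∧ ∀ᵐ x ∂μ, x ∈ Prod.fst '' Q := by
  set E : ℕ → Set X := fun k => Prod.fst '' (P k ∩ Prod.snd ⁻¹' A) with hE
  have hEm : ∀ k, MeasurableSet (E k) := fun k => ((hP.isBisection k).mono
    ((hP.isBisection k).measurableSet.inter (measurable_snd hA))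
      inter_subset_left).measurableSet_image_fst
  -- Each point is moved by the first piece of the partition that sends it into `A`.
  refine ⟨⋃ k, (P k ∩ Prod.snd ⁻¹' A) ∩ Prod.fst ⁻¹' disjointed E k,
    iUnion_mono fun k => inter_subset_left.trans inter_subset_left,
    MeasurableSet.iUnion fun k => ((hP.isBisection k).measurableSet.inter (measurable_snd hA)).inter
      (measurable_fst (MeasurableSet.disjointed hEm k)), ?_, ?_, ?_⟩
  · intro p hp q hq hpq
    obtain ⟨i, ⟨hpi, -⟩, hpd⟩ := mem_iUnion.1 hp
    obtain ⟨j, ⟨hqj, -⟩, hqd⟩ := mem_iUnion.1 hq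
    obtain rfl : i = j := by
      by_contra hij
      refine disjoint_left.1 (disjoint_disjointed E hij) hpd ?_
      rw [hpq]
      exact hqd
    exact (hP.isBisection i).injOn_fst hpi hqj hpq
  · exact iUnion_subset fun k p hp => hp.1.2
  · filter_upwards [hErg.ae_exists_rel hR hA hA0, measure_eq_zero_iff_ae_notMem.1 hP.null_fst]
      with x hx hxN
    obtain ⟨y, hy, hxy⟩ := hx
    have h1 : x ∈ ⋃ k, disjointed E k := by
      rw [iUnion_disjointed]
      by_contra h
      refine hxN ⟨(x, y), ⟨hxy, fun hP' => h ?_⟩, rfl⟩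
      obtain ⟨k, hk⟩ := mem_iUnion.1 hP'
      exact mem_iUnion.2 ⟨k, (x, y), ⟨hk, hy⟩, rfl⟩
    obtain ⟨k, hk⟩ := mem_iUnion.1 h1
    obtain ⟨p, hp, rfl⟩ := disjointed_subset E k hk
    exact ⟨p, mem_iUnion.2 ⟨k, hp, hk⟩, rfl⟩

/-- If `Q` is the graph of a map `φ`, there is a measure in the class of `μ` for which each
injective piece of `φ` is measure preserving, as a map to `(X, μ)`. -/
theorem exists_measureClass_hasRatio_one (hR : IsNonsingular R μ) {P : ℕ → Set (X × X)}
    (hP : IsBisectionPartition R μ P) {Q : Set (X × X)} (hQP : Q ⊆ ⋃ k, P k)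
    (hQ : MeasurableSet Q) (hinj : InjOn Prod.fst Q) (hfull : ∀ᵐ x ∂μ, x ∈ Prod.fst '' Q) :
    ∃ ν ∈ measureClass μ, ∀ k, HasRatio ν μ 1 1 (Q ∩ P k) := by
  have hμ : μ ∈ measureClass μ := ⟨inferInstance, .rfl, .rfl⟩
  have hQR : Q ⊆ graph R := hQP.trans (iUnion_subset fun k => (hP.isBisection k).subset_graph)
  -- This gives a set `E` the measure of its image under the map, counted with multiplicity. It may
  -- be infinite, but is finite on the sources of the pieces `Q ∩ P k`.
  set ν : Measure X := ((rightMeasure R μ).restrict Q).map Prod.fst with hν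
  have hνapp : ∀ E, MeasurableSet E → ν E = rightMeasure R μ (Prod.fst ⁻¹' E ∩ Q) := by
    intro E hE
    rw [hν, Measure.map_apply measurable_fst hE, Measure.restrict_apply (measurable_fst hE)]
  have hratio : ∀ V ⊆ Q, IsBisection R V → ν (Prod.fst '' V) = μ (Prod.snd '' V) := by
    intro V hVQ hV
    rw [hνapp _ hV.measurableSet_image_fst, ← hV.rightMeasure_apply hP .rfl]
    congr 1
    refine Subset.antisymm ?_ fun p hp => ⟨⟨p, hp, rfl⟩, hVQ hp⟩
    rintro p ⟨⟨q, hq, hqp⟩, hpQ⟩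
    rwa [← hinj (hVQ hq) hpQ hqp]
  have hQk : ∀ k, IsBisection R (Q ∩ P k) := fun k =>
    (hP.isBisection k).mono (hQ.inter (hP.isBisection k).measurableSet) inter_subset_right
  have hnull : ∀ E, MeasurableSet E → (ν E = 0 ↔ μ E = 0) := by
    intro E hE
    have hm : MeasurableSet (Prod.fst ⁻¹' E ∩ Q) := (measurable_fst hE).inter hQ
    have h1 : leftMeasure R μ (Prod.fst ⁻¹' E ∩ Q) = μ (Prod.fst '' (Prod.fst ⁻¹' E ∩ Q)) :=
      (hP.fst .rfl).bind_apply_of_injOn hm (inter_subset_right.trans hQR)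
        (hinj.mono inter_subset_right)
    rw [hνapp E hE, ← leftMeasure_null_iff hR hP hμ hm, h1, inter_comm, image_inter_preimage]
    refine ⟨fun h => measure_mono_null (fun x hx => ?_) (measure_union_null h (ae_iff.1 hfull)),
      measure_mono_null inter_subset_right⟩
    by_cases hxQ : x ∈ Prod.fst '' Q
    · exact Or.inl ⟨hxQ, hx⟩
    · exact Or.inr hxQ
  refine ⟨ν, ⟨?_, ?_, ?_⟩, ?_⟩
  · refine Measure.sigmaFinite_of_countable (S := insert (⋃ k, Prod.fst '' (Q ∩ P k))ᶜ
      (range fun k => Prod.fst '' (Q ∩ P k))) ((countable_range _).insert _) ?_ ?_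
    · rintro _ (rfl | ⟨k, rfl⟩)
      · rw [(hnull _ (MeasurableSet.iUnion fun k => (hQk k).measurableSet_image_fst).compl).2]
        · exact ENNReal.zero_lt_top
        · refine measure_mono_null ?_ (ae_iff.1 hfull)
          rintro x hx ⟨p, hp, rfl⟩
          obtain ⟨k, hk⟩ := mem_iUnion.1 (hQP hp)
          exact hx (mem_iUnion.2 ⟨k, p, ⟨hp, hk⟩, rfl⟩)
      · dsimp only
        rw [hratio _ inter_subset_left (hQk k)]
        exact measure_lt_top _ _
    · rw [sUnion_insert, sUnion_range, compl_union_self]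
  · exact Measure.AbsolutelyContinuous.mk fun E hE h => (hnull E hE).2 h
  · exact Measure.AbsolutelyContinuous.mk fun E hE h => (hnull E hE).1 h
  · intro k V hV hVm
    rw [one_mul, hratio V (hV.trans inter_subset_left) ((hQk k).mono hVm hV)]
    exact ⟨le_rfl, le_rfl⟩

/-- Every positive element of `S(R)` is approximately a ratio of a partial isomorphism inside any
given nonnull set. -/
theorem exists_hasRatio_of_mem_SInvariant (hR : IsNonsingular R μ) (hErg : IsErgodic R μ)
    {P : ℕ → Set (X × X)} (hP : IsBisectionPartition R μ P) {t c d : ℝ}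
    (ht : t ∈ SInvariant R μ) (hct : c < t) (htd : t < d) {A : Set X} (hA : MeasurableSet A)
    (hA0 : μ A ≠ 0) : ∃ V ⊆ A ×ˢ A, IsBisection R V ∧ μ (Prod.fst '' V) ≠ 0 ∧
      HasRatio μ μ (ENNReal.ofReal c) (ENNReal.ofReal d) V := by
  obtain ⟨Q, hQP, hQ, hinj, hQA, hfull⟩ := hErg.exists_graph_into hR hP hA hA0
  obtain ⟨ν, hν, hone⟩ := exists_measureClass_hasRatio_one hR hP hQP hQ hinj hfull
  have hQk : ∀ k, IsBisection R (Q ∩ P k) := fun k =>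
    (hP.isBisection k).mono (hQ.inter (hP.isBisection k).measurableSet) inter_subset_right
  have hmem : t ∈ ((rightMeasure R ν).map (modulus R ν)).support := mem_iInter₂.1 ht ν hν
  have hpos := (Measure.mem_support_iff_forall t).1 hmem (Ioo c d) (Ioo_mem_nhds hct htd)
  rw [Measure.map_apply (measurable_modulus R ν) measurableSet_Ioo] at hpos
  have hMm : MeasurableSet (modulus R ν ⁻¹' Ioo c d) := measurable_modulus R ν measurableSet_Ioo
  obtain ⟨k, hk⟩ := exists_rightMeasure_ne_zero hP hν.2.1 hMm hpos.ne'
  have hWb : IsBisection R (modulus R ν ⁻¹' Ioo c d ∩ P k) :=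
    (hP.isBisection k).mono (hMm.inter (hP.isBisection k).measurableSet) inter_subset_right
  have hWr := hWb.hasRatio_swap_of_modulus hR hP hν (c := c) (d := d)
    fun p hp => ⟨hp.1.1.le, hp.1.2.le⟩
  rw [← image_fst_preimage_swap] at hk
  set W : Set (X × X) := Prod.swap ⁻¹' (modulus R ν ⁻¹' Ioo c d ∩ P k) with hW
  replace hWb : IsBisection R W := hWb.swap
  replace hk : μ (Prod.fst '' W) ≠ 0 := fun h => hk (hν.2.1 h)
  set N : Set X := {x | x ∉ Prod.fst '' Q} with hN
  have hN0 : μ N = 0 := ae_iff.1 hfull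
  -- The map with graph `Q` is injective only piecewise, so `W` is cut down to sources in one piece
  -- and targets in another.
  have hWij : ∃ i j,
      μ (Prod.fst '' (W ∩ ((Prod.fst '' (Q ∩ P i)) ×ˢ (Prod.fst '' (Q ∩ P j))))) ≠ 0 := by
    by_contra hcon
    push Not at hcon
    refine hk (measure_mono_null ?_ (measure_union_null
      (measure_iUnion_null fun i => measure_iUnion_null (hcon i))
      (measure_union_null hN0 (hR.saturation_null N hN0))))
    have hmemQ : ∀ x, x ∈ Prod.fst '' Q → ∃ i, x ∈ Prod.fst '' (Q ∩ P i) := by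
      rintro _ ⟨p, hp, rfl⟩
      obtain ⟨i, hi⟩ := mem_iUnion.1 (hQP hp)
      exact ⟨i, p, ⟨hp, hi⟩, rfl⟩
    rintro _ ⟨p, hp, rfl⟩
    by_cases h1 : p.1 ∈ Prod.fst '' Q
    · by_cases h2 : p.2 ∈ Prod.fst '' Q
      · obtain ⟨i, hi⟩ := hmemQ _ h1
        obtain ⟨j, hj⟩ := hmemQ _ h2
        exact Or.inl (mem_iUnion.2 ⟨i, mem_iUnion.2 ⟨j, p, ⟨hp, hi, hj⟩, rfl⟩⟩)
      · exact Or.inr (Or.inr ⟨p.2, h2, R.symm (hWb.subset_graph hp)⟩)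
    · exact Or.inr (Or.inl h1)
  obtain ⟨i, j, hij⟩ := hWij
  set W' := W ∩ ((Prod.fst '' (Q ∩ P i)) ×ˢ (Prod.fst '' (Q ∩ P j))) with hW'
  have hWb' : IsBisection R W' := hWb.mono (hWb.measurableSet.inter
    ((hQk i).measurableSet_image_fst.prod (hQk j).measurableSet_image_fst)) inter_subset_left
  -- Conjugation of `W'` by the map. The outer factors have ratio 1 between `μ` and `ν`, so the
  -- `ν`-ratio of `W'` becomes a `μ`-ratio.
  refine ⟨compRel (compRel (Prod.swap ⁻¹' (Q ∩ P i)) W') (Q ∩ P j), ?_,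
    ((hQk i).swap.comp hWb').comp (hQk j), ?_, ?_⟩
  · rintro p ⟨y, ⟨z, h1, -⟩, h2⟩
    have h1' : p.1 ∈ A := hQA h1.1
    have h2' : (y, p.2) ∈ Prod.snd ⁻¹' A := hQA h2.1
    exact ⟨h1', h2'⟩
  · intro h0
    refine hij (measure_mono_null ?_ (hR.saturation_null _ h0))
    rintro _ ⟨p, hp, rfl⟩
    obtain ⟨⟨x, a⟩, hq, hqp⟩ := hp.2.1
    obtain ⟨⟨y, b⟩, hr, hrp⟩ := hp.2.2
    obtain rfl : x = p.1 := hqp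
    obtain rfl : y = p.2 := hrp
    exact ⟨a, ⟨(a, b), ⟨p.2, ⟨p.1, hq, hp⟩, hr⟩, rfl⟩, R.symm ((hQk i).subset_graph hq)⟩
  · have := HasRatio.comp ((hQk i).swap.comp hWb') (hQk j)
      (HasRatio.comp (hQk i).swap hWb' (hone i).swap_of_one (hWr.mono inter_subset_left)) (hone j)
    simpa using this

end Transport

end NonsingularRelation

namespace NonsingularRelation

/-! ### Unions and inverses of bisections -/

variable {X : Type*} [MeasurableSpace X] {R : Setoid X} {μ : Measure X}

theorem IsBisection.iUnion {ι : Type*} [Countable ι] {W : ι → Set (X × X)}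
    (hW : ∀ i, IsBisection R (W i))
    (hfst : Pairwise (Function.onFun Disjoint fun i => Prod.fst '' W i))
    (hsnd : Pairwise (Function.onFun Disjoint fun i => Prod.snd '' W i)) :
    IsBisection R (⋃ i, W i) := by
  refine ⟨MeasurableSet.iUnion fun i => (hW i).measurableSet,
    iUnion_subset fun i => (hW i).subset_graph, ?_, ?_⟩
  · intro p hp q hq h
    obtain ⟨i, hi⟩ := mem_iUnion.1 hp
    obtain ⟨j, hj⟩ := mem_iUnion.1 hq
    obtain rfl : i = j := by
      by_contra hij
      exact disjoint_left.1 (hfst hij) ⟨p, hi, rfl⟩ ⟨q, hj, h.symm⟩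
    exact (hW i).injOn_fst hi hj h
  · intro p hp q hq h
    obtain ⟨i, hi⟩ := mem_iUnion.1 hp
    obtain ⟨j, hj⟩ := mem_iUnion.1 hq
    obtain rfl : i = j := by
      by_contra hij
      exact disjoint_left.1 (hsnd hij) ⟨p, hi, rfl⟩ ⟨q, hj, h.symm⟩
    exact (hW i).injOn_snd hi hj h

theorem IsBisection.union {V W : Set (X × X)} (hV : IsBisection R V) (hW : IsBisection R W)
    (hfst : Disjoint (Prod.fst '' V) (Prod.fst '' W))
    (hsnd : Disjoint (Prod.snd '' V) (Prod.snd '' W)) : IsBisection R (V ∪ W) := by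
  rw [union_eq_iUnion]
  refine IsBisection.iUnion (Bool.forall_bool.2 ⟨hW, hV⟩) ?_ ?_
  · rintro (_ | _) (_ | _) h <;> first | exact absurd rfl h | exact hfst | exact hfst.symm
  · rintro (_ | _) (_ | _) h <;> first | exact absurd rfl h | exact hsnd | exact hsnd.symm

theorem HasRatio.swap {ν₁ ν₂ : Measure X} {a b : ℝ} (ha : 0 < a) (hb : 0 < b)
    {W : Set (X × X)} (h : HasRatio ν₁ ν₂ (ENNReal.ofReal a) (ENNReal.ofReal b) W) :
    HasRatio ν₂ ν₁ (ENNReal.ofReal b⁻¹) (ENNReal.ofReal a⁻¹) (Prod.swap ⁻¹' W) := by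
  intro V hV hVm
  have := h (Prod.swap ⁻¹' V) (fun p hp => by simpa using hV hp) (measurable_swap hVm)
  rw [image_fst_preimage_swap, image_snd_preimage_swap] at this
  rw [ENNReal.ofReal_inv_of_pos ha, ENNReal.ofReal_inv_of_pos hb]
  constructor
  · rw [mul_comm, ← div_eq_mul_inv]
    exact ENNReal.div_le_of_le_mul' this.2
  · rw [mul_comm, ← div_eq_mul_inv, ENNReal.le_div_iff_mul_le (Or.inl (by simpa using ha))
      (Or.inl ENNReal.ofReal_ne_top), mul_comm]
    exact this.1

variable [StandardBorelSpace X]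

/-! ### Partial isomorphisms of prescribed ratio -/

section NearlyConstantRatio

variable [IsFiniteMeasure μ]

/-- Between any two nonnull sets there is a partial isomorphism with nearly constant ratio. -/
theorem exists_hasRatio_zpow (hR : IsNonsingular R μ) (hErg : IsErgodic R μ)
    {P : ℕ → Set (X × X)} (hP : IsBisectionPartition R μ P) {g : ℝ} (hg : 1 < g) {A B : Set X}
    (hA : MeasurableSet A) (hB : MeasurableSet B) (hA0 : μ A ≠ 0) (hB0 : μ B ≠ 0) :
    ∃ j : ℤ, ∃ V ⊆ A ×ˢ B, IsBisection R V ∧ μ (Prod.fst '' V) ≠ 0 ∧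
      HasRatio μ μ (ENNReal.ofReal (g ^ j)) (ENNReal.ofReal (g ^ (j + 1))) V := by
  have hμ : μ ∈ measureClass μ := ⟨inferInstance, .rfl, .rfl⟩
  have hM : MeasurableSet (B ×ˢ A) := hB.prod hA
  have hM0 : rightMeasure R μ (B ×ˢ A) ≠ 0 := by
    have h1 : rightMeasure R μ (B ×ˢ A) = _ := (hP.snd .rfl).bind_apply hM
    rw [h1, Ne, ENNReal.tsum_eq_zero]
    intro h0
    refine hA0 (measure_mono_null ?_ (measure_union_null (measure_iUnion_null h0)
      (measure_union_null hP.null_snd (ae_iff.1 (hErg.ae_exists_rel hR hB hB0)))))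
    intro x hx
    by_cases hxB : ∃ y ∈ B, R x y
    · obtain ⟨y, hy, hxy⟩ := hxB
      by_cases hP' : (y, x) ∈ ⋃ k, P k
      · obtain ⟨k, hk⟩ := mem_iUnion.1 hP'
        exact Or.inl (mem_iUnion.2 ⟨k, (y, x), ⟨⟨hy, hx⟩, hk⟩, rfl⟩)
      · exact Or.inr (Or.inl ⟨(y, x), ⟨R.symm hxy, hP'⟩, rfl⟩)
    · exact Or.inr (Or.inr hxB)
  have hIm : ∀ j : ℤ, MeasurableSet (modulus R μ ⁻¹' Ico (g ^ j) (g ^ (j + 1))) := fun j =>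
    measurable_modulus R μ measurableSet_Ico
  obtain ⟨j, hj⟩ : ∃ j : ℤ,
      rightMeasure R μ (B ×ˢ A ∩ modulus R μ ⁻¹' Ico (g ^ j) (g ^ (j + 1))) ≠ 0 := by
    by_contra hcon
    push Not at hcon
    refine hM0 (measure_mono_null ?_ (measure_union_null (measure_iUnion_null hcon)
      (ae_iff.1 (ae_modulus_pos hR hP hμ))))
    intro p hp
    by_cases hpos : 0 < modulus R μ p
    · obtain ⟨j, hj⟩ := exists_mem_Ico_zpow hpos hg
      exact Or.inl (mem_iUnion.2 ⟨j, hp, hj⟩)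
    · exact Or.inr hpos
  obtain ⟨k, hk⟩ := exists_rightMeasure_ne_zero hP .rfl (hM.inter (hIm j)) hj
  have hWb : IsBisection R (B ×ˢ A ∩ modulus R μ ⁻¹' Ico (g ^ j) (g ^ (j + 1)) ∩ P k) :=
    (hP.isBisection k).mono ((hM.inter (hIm j)).inter (hP.isBisection k).measurableSet)
      inter_subset_right
  refine ⟨j, _, ?_, hWb.swap, by rwa [image_fst_preimage_swap],
    hWb.hasRatio_swap_of_modulus hR hP hμ fun p hp => ⟨hp.1.2.1, hp.1.2.2.le⟩⟩
  exact fun p hp => ⟨hp.1.1.2, hp.1.1.1⟩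

/-- For a relation of type `III_l`, the full pseudogroup moves mass between any two nonnull sets
with any prescribed ratio, up to a factor arbitrarily close to `l`. -/
theorem exists_hasRatio_of_typeIII (hR : IsNonsingular R μ) (hErg : IsErgodic R μ)
    {P : ℕ → Set (X × X)} (hP : IsBisectionPartition R μ P) {l : ℝ}
    (hType : IsTypeIIIParam R μ l) {C : ℝ} (hC : 0 < C) (hCl : C < l) {m : ℝ} (hm : 0 < m)
    {A B : Set X} (hA : MeasurableSet A) (hB : MeasurableSet B) (hA0 : μ A ≠ 0) (hB0 : μ B ≠ 0) :
    ∃ V ⊆ A ×ˢ B, IsBisection R V ∧ μ (Prod.fst '' V) ≠ 0 ∧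
      HasRatio μ μ (ENNReal.ofReal (C * m)) (ENNReal.ofReal m) V := by
  -- For `l < 1` take `s = l`. For `l = 1` every positive number lies in $S(R)$, and any `s`
  -- strictly between `C` and 1 serves.
  obtain ⟨s, hCs, hs1, hsS⟩ : ∃ s : ℝ, C < s ∧ s < 1 ∧ ∀ n : ℤ, s ^ n ∈ SInvariant R μ := by
    rcases hType.2 with ⟨-, hl1, hS⟩ | ⟨rfl, hS⟩
    · exact ⟨l, hCl, hl1, fun n => hS ▸ Or.inr ⟨n, rfl⟩⟩
    · obtain ⟨s, hs, hs'⟩ := exists_between hCl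
      refine ⟨s, hs, hs', fun n => hS ▸ ?_⟩
      exact mem_Ici.2 (zpow_nonneg (hC.trans hs).le n)
  have hs0 : 0 < s := hC.trans hCs
  -- The composite below has ratio between `t * γ / g` and `t * γ * g ^ 2`, a spread of `g ^ 3`.
  -- Rounding to a power of `s` costs a factor of at most `s⁻¹`, so the total loss is `C⁻¹`.
  obtain ⟨g, hg1, hg3⟩ : ∃ g : ℝ, 1 < g ∧ g ^ 3 = s / C := by
    have hsC : 1 < s / C := (one_lt_div hC).2 hCs
    refine ⟨(s / C) ^ ((3 : ℕ)⁻¹ : ℝ), Real.one_lt_rpow hsC (by positivity), ?_⟩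
    exact Real.rpow_inv_natCast_pow (by positivity) (by norm_num)
  have hg0 : 0 < g := zero_lt_one.trans hg1
  obtain ⟨j, W, hWAB, hWb, hW0, hWr⟩ := exists_hasRatio_zpow hR hErg hP hg1 hA hB hA0 hB0
  set γ : ℝ := g ^ j with hγ
  have hγ0 : 0 < γ := zpow_pos hg0 j
  have hγ' : g ^ (j + 1) = γ * g := zpow_add_one₀ hg0.ne' j
  -- The power `t` of `s` is the largest for which the upper end `t * γ * g ^ 2` does not exceed
  -- `m`.
  obtain ⟨k, hk1, hk2⟩ := exists_mem_Ico_zpow (x := m / (γ * g ^ 2)) (y := s⁻¹) (by positivity)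
    ((one_lt_inv₀ hs0).2 hs1)
  set t : ℝ := s ^ (-k) with ht
  have ht0 : 0 < t := zpow_pos hs0 _
  have htk : s⁻¹ ^ k = t := by rw [ht, inv_zpow, zpow_neg]
  have htk' : s⁻¹ ^ (k + 1) = t * s⁻¹ := by rw [zpow_add_one₀ (inv_ne_zero hs0.ne'), htk]
  rw [htk, le_div_iff₀ (by positivity)] at hk1
  rw [htk', div_lt_iff₀ (by positivity)] at hk2
  obtain ⟨V, hVA, hVb, hV0, hVr⟩ := exists_hasRatio_of_mem_SInvariant hR hErg hP (hsS (-k))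
    (c := t / g) (d := t * g) (div_lt_self ht0 hg1) (lt_mul_of_one_lt_right ht0 hg1)
    hWb.measurableSet_image_fst hW0
  refine ⟨compRel V W, ?_, hVb.comp hWb, ?_, ?_⟩
  · rintro p ⟨y, h1, h2⟩
    obtain ⟨q, hq, hqp⟩ := (hVA h1).1
    have h3 : p.1 ∈ A := by
      rw [← (hqp : q.1 = p.1)]
      exact (hWAB hq).1
    exact ⟨h3, (hWAB h2).2⟩
  · have : Prod.fst '' compRel V W = Prod.fst '' V := by
      refine Subset.antisymm ?_ ?_
      · rintro _ ⟨p, ⟨y, h1, -⟩, rfl⟩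
        exact ⟨_, h1, rfl⟩
      · rintro _ ⟨p, hp, rfl⟩
        obtain ⟨⟨y, z⟩, hq, hqp⟩ := (hVA hp).2
        obtain rfl : y = p.2 := hqp
        exact ⟨(p.1, z), ⟨p.2, hp, hq⟩, rfl⟩
    rwa [this]
  · refine (HasRatio.comp hVb hWb hVr hWr).weaken ?_ ?_
    · rw [← ENNReal.ofReal_mul hγ0.le]
      refine ENNReal.ofReal_le_ofReal ?_
      rw [eq_div_iff hC.ne'] at hg3
      rw [mul_div_assoc', le_div_iff₀ hg0]
      have h1 : m * s < t * (γ * g ^ 2) := by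
        have := mul_lt_mul_of_pos_right hk2 hs0
        calc m * s < t * s⁻¹ * (γ * g ^ 2) * s := this
          _ = t * (γ * g ^ 2) := by field_simp
      rw [← hg3] at h1
      have h2 : (C * m * g) * g ^ 2 < (γ * t) * g ^ 2 := by linarith
      exact (lt_of_mul_lt_mul_right h2 (by positivity)).le
    · rw [hγ', ← ENNReal.ofReal_mul (by positivity)]
      refine ENNReal.ofReal_le_ofReal ?_
      calc γ * g * (t * g) = t * (γ * g ^ 2) := by ring
        _ ≤ m := hk1

end NearlyConstantRatio

/-! ### Exhaustion by disjoint pieces -/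

section Exhaustion

theorem HasRatio.iUnion {ι : Type*} [Countable ι] {W : ι → Set (X × X)}
    (hW : ∀ i, IsBisection R (W i))
    (hfst : Pairwise (Function.onFun Disjoint fun i => Prod.fst '' W i))
    (hsnd : Pairwise (Function.onFun Disjoint fun i => Prod.snd '' W i))
    {ν₁ ν₂ : Measure X} {a b : ENNReal} (h : ∀ i, HasRatio ν₁ ν₂ a b (W i)) :
    HasRatio ν₁ ν₂ a b (⋃ i, W i) := by
  intro V hV hVm
  have hVi : ∀ i, IsBisection R (V ∩ W i) := fun i =>
    (hW i).mono (hVm.inter (hW i).measurableSet) inter_subset_right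
  have hVeq : V = ⋃ i, V ∩ W i := by rw [← inter_iUnion, inter_eq_left.2 hV]
  have e1 : ν₁ (Prod.fst '' V) = ∑' i, ν₁ (Prod.fst '' (V ∩ W i)) := by
    conv_lhs => rw [hVeq, image_iUnion]
    exact measure_iUnion (fun i j hij => (hfst hij).mono (image_mono inter_subset_right)
      (image_mono inter_subset_right)) fun i => (hVi i).measurableSet_image_fst
  have e2 : ν₂ (Prod.snd '' V) = ∑' i, ν₂ (Prod.snd '' (V ∩ W i)) := by
    conv_lhs => rw [hVeq, image_iUnion]
    exact measure_iUnion (fun i j hij => (hsnd hij).mono (image_mono inter_subset_right)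
      (image_mono inter_subset_right)) fun i => (hVi i).measurableSet_image_snd
  rw [e1, e2, ← ENNReal.tsum_mul_left, ← ENNReal.tsum_mul_left]
  exact ⟨ENNReal.tsum_le_tsum fun i => (h i _ inter_subset_right (hVi i).measurableSet).1,
    ENNReal.tsum_le_tsum fun i => (h i _ inter_subset_right (hVi i).measurableSet).2⟩

theorem HasRatio.union {V W : Set (X × X)} (hV : IsBisection R V) (hW : IsBisection R W)
    (hfst : Disjoint (Prod.fst '' V) (Prod.fst '' W))
    (hsnd : Disjoint (Prod.snd '' V) (Prod.snd '' W)) {ν₁ ν₂ : Measure X} {a b : ENNReal}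
    (h : HasRatio ν₁ ν₂ a b V) (h' : HasRatio ν₁ ν₂ a b W) : HasRatio ν₁ ν₂ a b (V ∪ W) := by
  rw [union_eq_iUnion]
  refine HasRatio.iUnion (R := R) (Bool.forall_bool.2 ⟨hW, hV⟩) ?_ ?_ (Bool.forall_bool.2 ⟨h', h⟩)
  · rintro (_ | _) (_ | _) h <;> first | exact absurd rfl h | exact hfst | exact hfst.symm
  · rintro (_ | _) (_ | _) h <;> first | exact absurd rfl h | exact hsnd | exact hsnd.symm

/-- Exhaustion: if small partial isomorphisms of bounded ratio exist between all nonnull subsets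
of `A` and `B`, there is one which exhausts `A` or `B`. -/
theorem exists_hasRatio_exhausting [IsFiniteMeasure μ] {A B : Set X} (hA : MeasurableSet A)
    (hB : MeasurableSet B) {a b : ENNReal}
    (h : ∀ A' B', MeasurableSet A' → MeasurableSet B' → μ A' ≠ 0 → μ B' ≠ 0 →
      ∃ V ⊆ A' ×ˢ B', IsBisection R V ∧ μ (Prod.fst '' V) ≠ 0 ∧ HasRatio μ μ a b V) :
    ∃ F ⊆ A ×ˢ B, IsBisection R F ∧ HasRatio μ μ a b F ∧
      (μ (A \ Prod.fst '' F) = 0 ∨ μ (B \ Prod.snd '' F) = 0) := by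
  set r : Set (X × X) → Set (X × X) → Prop := fun V W =>
    Disjoint (Prod.fst '' V) (Prod.fst '' W) ∧ Disjoint (Prod.snd '' V) (Prod.snd '' W) with hr
  set good : Set (Set (X × X)) := {V | V ⊆ A ×ˢ B ∧ IsBisection R V ∧ μ (Prod.fst '' V) ≠ 0 ∧
    HasRatio μ μ a b V} with hgood
  obtain ⟨𝒱, h𝒱⟩ := zorn_subset {𝒱 : Set (Set (X × X)) | 𝒱 ⊆ good ∧ 𝒱.Pairwise r} (by
    intro c hc hchain
    refine ⟨⋃₀ c, ⟨sUnion_subset fun s hs => (hc hs).1, ?_⟩, fun s hs => subset_sUnion_of_mem hs⟩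
    exact (pairwise_sUnion hchain.directedOn).2 fun s hs => (hc hs).2)
  obtain ⟨h𝒱g, h𝒱p⟩ := h𝒱.prop
  have hfst : Pairwise (Function.onFun Disjoint fun V : 𝒱 => Prod.fst '' (V : Set (X × X))) :=
    fun V W hVW => (h𝒱p V.2 W.2 (Subtype.coe_ne_coe.2 hVW)).1
  have hsnd : Pairwise (Function.onFun Disjoint fun V : 𝒱 => Prod.snd '' (V : Set (X × X))) :=
    fun V W hVW => (h𝒱p V.2 W.2 (Subtype.coe_ne_coe.2 hVW)).2
  -- The sources are disjoint and nonnull in a finite measure space.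
  have hcount : Countable 𝒱 := by
    have := Measure.countable_meas_pos_of_disjoint_iUnion (μ := μ)
      (As := fun V : 𝒱 => Prod.fst '' (V : Set (X × X)))
      (fun V => (h𝒱g V.2).2.1.measurableSet_image_fst) hfst
    rw [← countable_univ_iff]
    refine this.mono fun V _ => pos_iff_ne_zero.2 (h𝒱g V.2).2.2.1
  have hFb : IsBisection R (⋃ V : 𝒱, (V : Set (X × X))) :=
    IsBisection.iUnion (fun V => (h𝒱g V.2).2.1) hfst hsnd
  refine ⟨⋃ V : 𝒱, (V : Set (X × X)), iUnion_subset fun V => (h𝒱g V.2).1, hFb,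
    HasRatio.iUnion (fun V => (h𝒱g V.2).2.1) hfst hsnd fun V => (h𝒱g V.2).2.2.2, ?_⟩
  set F := ⋃ V : 𝒱, (V : Set (X × X)) with hF
  by_contra hcon
  push Not at hcon
  obtain ⟨V, hVs, hVb, hV0, hVr⟩ := h _ _ (hA.diff hFb.measurableSet_image_fst)
    (hB.diff hFb.measurableSet_image_snd) hcon.1 hcon.2
  have hins : insert V 𝒱 ⊆ good ∧ (insert V 𝒱).Pairwise r := by
    refine ⟨insert_subset ⟨fun p hp => ⟨(hVs hp).1.1, (hVs hp).2.1⟩, hVb, hV0, hVr⟩ h𝒱g, ?_⟩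
    have : Std.Symm r := ⟨fun V W hVW => ⟨hVW.1.symm, hVW.2.symm⟩⟩
    refine h𝒱p.insert_of_symm fun W hW _ => ⟨?_, ?_⟩
    · refine disjoint_left.2 ?_
      rintro _ ⟨p, hp, rfl⟩ ⟨q, hq, hqp⟩
      exact (hVs hp).1.2 ⟨q, mem_iUnion.2 ⟨⟨W, hW⟩, hq⟩, hqp⟩
    · refine disjoint_left.2 ?_
      rintro _ ⟨p, hp, rfl⟩ ⟨q, hq, hqp⟩
      exact (hVs hp).2.2 ⟨q, mem_iUnion.2 ⟨⟨W, hW⟩, hq⟩, hqp⟩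
  -- By maximality `V` already belongs to the family, yet its sources avoid those of the family;
  -- hence it is empty, against being nonnull.
  have hV𝒱 : V ∈ 𝒱 := h𝒱.le_of_ge hins (subset_insert _ _) (mem_insert _ _)
  refine hV0 ?_
  rw [show V = ∅ from eq_empty_of_forall_notMem fun p hp =>
    (hVs hp).1.2 ⟨p, mem_iUnion.2 ⟨⟨V, hV𝒱⟩, hp⟩, rfl⟩]
  simp

end Exhaustion

/-! ### Cantor–Bernstein and the comparison of sets -/

section CantorBernstein

/-- A measurable Cantor–Bernstein theorem: combine a partial isomorphism `F` from `A` into `B` with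
the inverse `G` of one from `B` into `A`. -/
theorem exists_hasRatio_cantorBernstein {A B : Set X} (hA : MeasurableSet A) {a b : ENNReal}
    {F G : Set (X × X)} (hF : IsBisection R F) (hG : IsBisection R G) (hFs : F ⊆ A ×ˢ B)
    (hGs : G ⊆ A ×ˢ B) (hFr : HasRatio μ μ a b F) (hGr : HasRatio μ μ a b G)
    (hF0 : μ (A \ Prod.fst '' F) = 0) (hG0 : μ (B \ Prod.snd '' G) = 0) :
    ∃ H ⊆ A ×ˢ B, IsBisection R H ∧ HasRatio μ μ a b H ∧
      μ (A \ Prod.fst '' H) = 0 ∧ μ (B \ Prod.snd '' H) = 0 := by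
  -- The points of `A` missed by the sources of `G`, and their iterates under `F` followed by the
  -- inverse of `G`. On the union `S` of these sets `F` is used, elsewhere `G`.
  let T : ℕ → Set X := fun n => Nat.rec (A \ Prod.fst '' G)
    (fun _ T => Prod.fst '' (G ∩ Prod.snd ⁻¹' (Prod.snd '' (F ∩ Prod.fst ⁻¹' T)))) n
  have hT0 : T 0 = A \ Prod.fst '' G := rfl
  have hTs : ∀ n, T (n + 1) =
    Prod.fst '' (G ∩ Prod.snd ⁻¹' (Prod.snd '' (F ∩ Prod.fst ⁻¹' T n))) := fun n => rfl
  have hTm : ∀ n, MeasurableSet (T n) := by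
    intro n
    induction n with
    | zero => exact hA.diff hG.measurableSet_image_fst
    | succ n ih =>
      have h1 := (hF.mono (hF.measurableSet.inter (measurable_fst ih))
        inter_subset_left).measurableSet_image_snd
      exact (hG.mono (hG.measurableSet.inter (measurable_snd h1))
        inter_subset_left).measurableSet_image_fst
  set S : Set X := ⋃ n, T n with hS
  have hSm : MeasurableSet S := MeasurableSet.iUnion hTm
  have hF' : IsBisection R (F ∩ Prod.fst ⁻¹' S) :=
    hF.mono (hF.measurableSet.inter (measurable_fst hSm)) inter_subset_left
  have hG' : IsBisection R (G ∩ Prod.fst ⁻¹' Sᶜ) :=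
    hG.mono (hG.measurableSet.inter (measurable_fst hSm.compl)) inter_subset_left
  have hfst : Disjoint (Prod.fst '' (F ∩ Prod.fst ⁻¹' S)) (Prod.fst '' (G ∩ Prod.fst ⁻¹' Sᶜ)) := by
    refine disjoint_left.2 ?_
    rintro _ ⟨p, hp, rfl⟩ ⟨q, hq, hqp⟩
    have hqS : q.1 ∉ S := hq.2
    rw [hqp] at hqS
    exact hqS hp.2
  have hsnd : Disjoint (Prod.snd '' (F ∩ Prod.fst ⁻¹' S)) (Prod.snd '' (G ∩ Prod.fst ⁻¹' Sᶜ)) := by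
    refine disjoint_left.2 ?_
    rintro _ ⟨p, hp, rfl⟩ ⟨q, hq, hqp⟩
    obtain ⟨n, hn⟩ := mem_iUnion.1 hp.2
    refine hq.2 (mem_iUnion.2 ⟨n + 1, ?_⟩)
    rw [hTs]
    exact ⟨q, ⟨hq.1, p, ⟨hp.1, hn⟩, hqp.symm⟩, rfl⟩
  refine ⟨F ∩ Prod.fst ⁻¹' S ∪ G ∩ Prod.fst ⁻¹' Sᶜ,
    union_subset (inter_subset_left.trans hFs) (inter_subset_left.trans hGs),
    hF'.union hG' hfst hsnd, HasRatio.union hF' hG' hfst hsnd (hFr.mono inter_subset_left)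
      (hGr.mono inter_subset_left), measure_mono_null ?_ hF0, measure_mono_null ?_ hG0⟩
  · rintro x ⟨hxA, hx⟩
    refine ⟨hxA, ?_⟩
    rintro ⟨p, hp, rfl⟩
    refine hx ?_
    by_cases hpS : p.1 ∈ S
    · exact ⟨p, Or.inl ⟨hp, hpS⟩, rfl⟩
    · have : p.1 ∈ Prod.fst '' G := by
        by_contra h
        exact hpS (mem_iUnion.2 ⟨0, hxA, h⟩)
      obtain ⟨q, hq, hqp⟩ := this
      refine ⟨q, Or.inr ⟨hq, ?_⟩, hqp⟩
      rw [mem_preimage, hqp]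
      exact hpS
  · rintro y ⟨hyB, hy⟩
    refine ⟨hyB, ?_⟩
    rintro ⟨p, hp, rfl⟩
    refine hy ?_
    by_cases hpS : p.1 ∈ S
    · obtain ⟨n, hn⟩ := mem_iUnion.1 hpS
      rcases n with _ | n
      · exact absurd ⟨p, hp, rfl⟩ hn.2
      · rw [hTs] at hn
        obtain ⟨q, ⟨hq, ⟨w, ⟨hwF, hwT⟩, hwq⟩⟩, hqp⟩ := hn
        obtain rfl := hG.injOn_fst hq hp hqp
        exact ⟨w, Or.inl ⟨hwF, mem_iUnion.2 ⟨n, hwT⟩⟩, hwq⟩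
    · exact ⟨p, Or.inr ⟨hp, hpS⟩, rfl⟩

end CantorBernstein

/-- One half of the comparison: a partial isomorphism with ratio at most `μ B / μ A` that is
defined on all of `A`. -/
theorem exists_hasRatio_full_source [IsFiniteMeasure μ] (hR : IsNonsingular R μ)
    (hErg : IsErgodic R μ) {P : ℕ → Set (X × X)} (hP : IsBisectionPartition R μ P) {l : ℝ}
    (hType : IsTypeIIIParam R μ l) {C : ℝ} (hC : 0 < C) (hCl : C < l)
    {A B : Set X} (hA : MeasurableSet A) (hB : MeasurableSet B) (hA0 : μ A ≠ 0) (hB0 : μ B ≠ 0) :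
    ∃ F ⊆ A ×ˢ B, IsBisection R F ∧ μ (A \ Prod.fst '' F) = 0 ∧
      HasRatio μ μ (ENNReal.ofReal (C * (μ.real B / μ.real A)))
        (ENNReal.ofReal (μ.real B / μ.real A)) F := by
  have hAr : 0 < μ.real A := ENNReal.toReal_pos hA0 (measure_ne_top _ _)
  have hBr : 0 < μ.real B := ENNReal.toReal_pos hB0 (measure_ne_top _ _)
  obtain ⟨F, hFs, hFb, hFr, hF0⟩ := exists_hasRatio_exhausting (R := R) (μ := μ) hA hB
    fun A' B' hA' hB' hA0' hB0' => exists_hasRatio_of_typeIII hR hErg hP hType hC hCl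
      (m := μ.real B / μ.real A) (by positivity) hA' hB' hA0' hB0'
  refine ⟨F, hFs, hFb, ?_, hFr⟩
  rcases hF0 with h | h
  · exact h
  have hfA : Prod.fst '' F ⊆ A := by rintro _ ⟨p, hp, rfl⟩; exact (hFs hp).1
  -- If `B` is exhausted, the ratio bound $\mu(B)/\mu(A)$ leaves the source of `F` no less measure
  -- than `A`.
  have h1 : μ B ≤ μ (Prod.snd '' F) := by
    have : B ⊆ (B \ Prod.snd '' F) ∪ Prod.snd '' F := by
      rw [sdiff_union_self]; exact subset_union_left
    refine (measure_mono this).trans ((measure_union_le _ _).trans ?_)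
    rw [h, zero_add]
  have h2 := h1.trans (hFr F Subset.rfl hFb.measurableSet).2
  have h3 : μ.real B ≤ μ.real B / μ.real A * μ.real (Prod.fst '' F) := by
    have := ENNReal.toReal_mono (ENNReal.mul_ne_top ENNReal.ofReal_ne_top (measure_ne_top _ _)) h2
    rwa [ENNReal.toReal_mul, ENNReal.toReal_ofReal (by positivity)] at this
  have h4 : μ.real A ≤ μ.real (Prod.fst '' F) := by
    rw [div_mul_eq_mul_div, le_div_iff₀ hAr] at h3
    exact le_of_mul_le_mul_left h3 hBr
  rw [measure_sdiff hfA hFb.measurableSet_image_fst.nullMeasurableSet (measure_ne_top _ _)]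
  exact tsub_eq_zero_of_le
    ((ENNReal.toReal_le_toReal (measure_ne_top _ _) (measure_ne_top _ _)).1 h4)

/-- The comparison theorem, in terms of bisections. -/
theorem exists_hasRatio_full [IsFiniteMeasure μ] (hR : IsNonsingular R μ)
    (hErg : IsErgodic R μ) {P : ℕ → Set (X × X)} (hP : IsBisectionPartition R μ P) {l : ℝ}
    (hType : IsTypeIIIParam R μ l) {C : ℝ} (hC : 0 < C) (hCl : C < l)
    {A B : Set X} (hA : MeasurableSet A) (hB : MeasurableSet B) (hA0 : μ A ≠ 0) (hB0 : μ B ≠ 0) :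
    ∃ H ⊆ A ×ˢ B, IsBisection R H ∧
      HasRatio μ μ (ENNReal.ofReal (C * (μ.real B / μ.real A)))
        (ENNReal.ofReal (C⁻¹ * (μ.real B / μ.real A))) H ∧
      μ (A \ Prod.fst '' H) = 0 ∧ μ (B \ Prod.snd '' H) = 0 := by
  have hAr : 0 < μ.real A := ENNReal.toReal_pos hA0 (measure_ne_top _ _)
  have hBr : 0 < μ.real B := ENNReal.toReal_pos hB0 (measure_ne_top _ _)
  have hm : 0 < μ.real B / μ.real A := by positivity
  have hl1 : l ≤ 1 := by
    rcases hType.2 with ⟨-, h, -⟩ | ⟨h, -⟩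
    exacts [h.le, h.le]
  have hC1 : C ≤ 1 := hCl.le.trans hl1
  have hC1' : 1 ≤ C⁻¹ := (one_le_inv₀ hC).2 hC1
  obtain ⟨F, hFs, hFb, hF0, hFr⟩ :=
    exists_hasRatio_full_source hR hErg hP hType hC hCl hA hB hA0 hB0
  obtain ⟨G, hGs, hGb, hG0, hGr⟩ :=
    exists_hasRatio_full_source hR hErg hP hType hC hCl hB hA hB0 hA0
  -- With $m=\mu(B)/\mu(A)$, the map `F` has ratio in $[Cm,m]$ and the inverse of `G` has ratio in
  -- $[m,C^{-1}m]$, so both lie in $[Cm,C^{-1}m]$.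
  refine exists_hasRatio_cantorBernstein hA hFb hGb.swap hFs (fun p hp => (hGs hp).symm)
    (hFr.weaken le_rfl ?_) ((hGr.swap (by positivity) (by positivity)).weaken ?_ ?_) hF0
    (by rwa [image_snd_preimage_swap])
  · exact ENNReal.ofReal_le_ofReal (le_mul_of_one_le_left hm.le hC1')
  · refine ENNReal.ofReal_le_ofReal ?_
    rw [inv_div]
    exact mul_le_of_le_one_left hm.le hC1
  · refine ENNReal.ofReal_le_ofReal ?_
    rw [mul_inv, inv_div]

end NonsingularRelation

namespace NonsingularRelation

/-! ### From bisections to elements of `[[R]]` -/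

section PartialIsomorphism

open Classical in
/-- The partial map with graph `W`, extended by the identity. -/
noncomputable def sectionMap {X : Type*} (W : Set (X × X)) (x : X) : X :=
  if h : ∃ y, (x, y) ∈ W then h.choose else x

theorem sectionMap_eq {X : Type*} {W : Set (X × X)} (hW : InjOn Prod.fst W) {p : X × X}
    (hp : p ∈ W) : sectionMap W p.1 = p.2 := by
  have h : ∃ y, (p.1, y) ∈ W := ⟨p.2, hp⟩
  rw [sectionMap, dif_pos h]
  exact congrArg Prod.snd (hW h.choose_spec hp rfl)

variable {X : Type*} [MeasurableSpace X] {R : Setoid X} {μ : Measure X} {W : Set (X × X)}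

/-- The partial isomorphism with graph `W`. -/
noncomputable def IsBisection.toPartialEquiv (hW : IsBisection R W) : PartialEquiv X X where
  toFun := sectionMap W
  invFun := sectionMap (Prod.swap ⁻¹' W)
  source := Prod.fst '' W
  target := Prod.snd '' W
  map_source' := by
    rintro _ ⟨p, hp, rfl⟩
    exact ⟨p, hp, (sectionMap_eq hW.injOn_fst hp).symm⟩
  map_target' := by
    rintro _ ⟨p, hp, rfl⟩
    exact ⟨p, hp, (sectionMap_eq hW.swap.injOn_fst (p := p.swap) hp).symm⟩
  left_inv' := by
    rintro _ ⟨p, hp, rfl⟩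
    rw [sectionMap_eq hW.injOn_fst hp]
    exact sectionMap_eq hW.swap.injOn_fst (p := p.swap) hp
  right_inv' := by
    rintro _ ⟨p, hp, rfl⟩
    rw [show sectionMap (Prod.swap ⁻¹' W) p.2 = p.1 from
      sectionMap_eq hW.swap.injOn_fst (p := p.swap) hp]
    exact sectionMap_eq hW.injOn_fst hp

theorem IsBisection.toPartialEquiv_apply (hW : IsBisection R W) {p : X × X} (hp : p ∈ W) :
    hW.toPartialEquiv p.1 = p.2 :=
  sectionMap_eq hW.injOn_fst hp

theorem IsBisection.toPartialEquiv_symm_apply (hW : IsBisection R W) {p : X × X} (hp : p ∈ W) :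
    hW.toPartialEquiv.symm p.2 = p.1 :=
  sectionMap_eq hW.swap.injOn_fst (p := p.swap) hp

variable [StandardBorelSpace X]

theorem IsBisection.measurable_domRestrict_sectionMap (hW : IsBisection R W) :
    Measurable ((Prod.fst '' W).domRestrict (sectionMap W)) := by
  intro E hE
  have hm : MeasurableSet (Prod.fst '' (W ∩ Prod.snd ⁻¹' E)) :=
    (hW.mono (hW.measurableSet.inter (measurable_snd hE)) inter_subset_left).measurableSet_image_fst
  convert measurable_subtype_coe hm using 1
  ext ⟨x, p, hp, rfl⟩
  simp only [mem_preimage, domRestrict_apply, sectionMap_eq hW.injOn_fst hp]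
  constructor
  · exact fun h => ⟨p, ⟨hp, h⟩, rfl⟩
  · rintro ⟨q, ⟨hq, hqE⟩, hqp⟩
    rwa [← hW.injOn_fst hq hp hqp]

theorem IsBisection.toPartialEquiv_mem (hR : IsNonsingular R μ) (hW : IsBisection R W) :
    hW.toPartialEquiv ∈ fullPseudogroup R μ := by
  refine ⟨⟨hW.measurableSet_image_fst, hW.measurableSet_image_snd,
    hW.measurable_domRestrict_sectionMap, ?_, ?_⟩, ?_⟩
  · have := hW.swap.measurable_domRestrict_sectionMap
    rwa [image_fst_preimage_swap] at this
  · intro N hN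
    have h1 : hW.toPartialEquiv '' N = Prod.snd '' (W ∩ Prod.fst ⁻¹' N) := by
      refine Subset.antisymm ?_ ?_
      · rintro _ ⟨x, hx, rfl⟩
        obtain ⟨p, hp, rfl⟩ := hN hx
        exact ⟨p, ⟨hp, hx⟩, (hW.toPartialEquiv_apply hp).symm⟩
      · rintro _ ⟨p, ⟨hp, hpN⟩, rfl⟩
        exact ⟨p.1, hpN, hW.toPartialEquiv_apply hp⟩
    have h2 : Prod.fst '' (W ∩ Prod.fst ⁻¹' N) = N := by
      rw [image_inter_preimage]
      exact inter_eq_right.2 hN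
    rw [h1, ← hR.null_image_iff (inter_subset_left.trans hW.subset_graph), h2]
  · refine ae_of_all _ ?_
    rintro _ ⟨p, hp, rfl⟩
    rw [hW.toPartialEquiv_apply hp]
    exact hW.subset_graph hp

theorem IsBisection.compMeasure_apply (hW : IsBisection R W) {E : Set X} (hE : MeasurableSet E) :
    compMeasure μ hW.toPartialEquiv E = μ (Prod.snd '' (W ∩ Prod.fst ⁻¹' E)) := by
  have hm := hW.swap.measurable_domRestrict_sectionMap
  rw [image_fst_preimage_swap] at hm
  have hae : AEMeasurable hW.toPartialEquiv.symm (μ.restrict hW.toPartialEquiv.target) :=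
    aemeasurable_restrict_of_measurable_subtype hW.measurableSet_image_snd hm
  rw [compMeasure, Measure.map_apply_of_aemeasurable hae hE,
    Measure.restrict_apply' (show MeasurableSet hW.toPartialEquiv.target from
      hW.measurableSet_image_snd)]
  congr 1
  refine Subset.antisymm ?_ ?_
  · rintro _ ⟨h, p, hp, rfl⟩
    rw [mem_preimage, hW.toPartialEquiv_symm_apply hp] at h
    exact ⟨p, ⟨hp, h⟩, rfl⟩
  · rintro _ ⟨p, ⟨hp, hpE⟩, rfl⟩
    refine ⟨?_, p, hp, rfl⟩
    rw [mem_preimage, hW.toPartialEquiv_symm_apply hp]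
    exact hpE

/-- `HasRatio` bounds the measure of every measurable set, and such bounds pass to the density a.e.
The lower bound is confined to the source, off which the composed measure vanishes. -/
theorem IsBisection.ae_derivative_mem_Icc [IsFiniteMeasure μ] (hW : IsBisection R W) {a b : ℝ}
    (hb : 0 ≤ b) (h : HasRatio μ μ (ENNReal.ofReal a) (ENNReal.ofReal b) W) :
    ∀ᵐ x ∂μ, x ∈ Prod.fst '' W → a ≤ derivative μ hW.toPartialEquiv x ∧
      derivative μ hW.toPartialEquiv x ≤ b := by
  have hr : ∀ E, MeasurableSet E →
      ENNReal.ofReal a * μ (Prod.fst '' W ∩ E) ≤ compMeasure μ hW.toPartialEquiv E ∧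
      compMeasure μ hW.toPartialEquiv E ≤ ENNReal.ofReal b * μ (Prod.fst '' W ∩ E) := by
    intro E hE
    rw [hW.compMeasure_apply hE, ← image_inter_preimage]
    exact h _ inter_subset_left (hW.measurableSet.inter (measurable_fst hE))
  have hfin : IsFiniteMeasure (compMeasure μ hW.toPartialEquiv) := by
    rw [compMeasure]; infer_instance
  have hac : compMeasure μ hW.toPartialEquiv ≪ μ := by
    refine Measure.AbsolutelyContinuous.mk fun E hE h0 => ?_
    have := (hr E hE).2
    rwa [measure_mono_null inter_subset_right h0, mul_zero, nonpos_iff_eq_zero] at this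
  have hlow : (Prod.fst '' W).indicator (fun _ => ENNReal.ofReal a) ≤ᵐ[μ]
      (compMeasure μ hW.toPartialEquiv).rnDeriv μ := by
    refine ae_le_of_forall_setLIntegral_le_of_sigmaFinite
      (measurable_const.indicator hW.measurableSet_image_fst) fun s hs _ => ?_
    rw [Measure.setLIntegral_rnDeriv hac, lintegral_indicator hW.measurableSet_image_fst,
      setLIntegral_const, Measure.restrict_apply hW.measurableSet_image_fst]
    exact (hr s hs).1
  have hup : (compMeasure μ hW.toPartialEquiv).rnDeriv μ ≤ᵐ[μ] fun _ => ENNReal.ofReal b := by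
    refine ae_le_of_forall_setLIntegral_le_of_sigmaFinite (Measure.measurable_rnDeriv _ _)
      fun s hs _ => ?_
    rw [Measure.setLIntegral_rnDeriv hac, setLIntegral_const]
    exact (hr s hs).2.trans (mul_le_mul_right (measure_mono inter_subset_right) _)
  filter_upwards [hlow, hup] with x h1 h2 hx
  rw [indicator_of_mem hx] at h1
  have hne : (compMeasure μ hW.toPartialEquiv).rnDeriv μ x ≠ ⊤ :=
    (h2.trans_lt ENNReal.ofReal_lt_top).ne
  exact ⟨(ENNReal.ofReal_le_iff_le_toReal hne).1 h1, ENNReal.toReal_le_of_le_ofReal hb h2⟩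

theorem IsBisection.isMuBounded [IsFiniteMeasure μ] (hW : IsBisection R W) {a b : ℝ}
    (ha : 0 < a) (hb : 0 ≤ b) (h : HasRatio μ μ (ENNReal.ofReal a) (ENNReal.ofReal b) W) :
    IsMuBounded μ hW.toPartialEquiv := by
  refine ⟨max |Real.log a| |Real.log b|, ?_⟩
  filter_upwards [hW.ae_derivative_mem_Icc hb h] with x hx hxW
  obtain ⟨h1, h2⟩ := hx hxW
  exact abs_le_max_abs_abs (Real.log_le_log ha h1) (Real.log_le_log (ha.trans_le h1) h2)

end PartialIsomorphism

/-! ### Density of bounded elements in the full group -/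

section FullGroup

variable {X : Type*} [MeasurableSpace X] {R : Setoid X} {μ : Measure X}

theorem null_compl_image_fst_graph {θ : PartialEquiv X X} (hθ : θ ∈ fullPseudogroup R μ)
    (hs : θ.source =ᵐ[μ] univ) :
    μ (Prod.fst '' (graph R ∩ {p | p.1 ∈ θ.source ∧ θ p.1 = p.2}))ᶜ = 0 := by
  rw [ae_eq_univ] at hs
  refine measure_mono_null ?_ (measure_union_null hs (ae_iff.1 hθ.2))
  intro x hx
  by_contra h
  rw [mem_union, not_or] at h
  have hxs : x ∈ θ.source := by
    by_contra h'
    exact h.1 h'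
  have hxR : R x (θ x) := by
    by_contra h'
    exact h.2 fun hh => h' (hh hxs)
  exact hx ⟨(x, θ x), ⟨hxR, hxs, rfl⟩, rfl⟩

/-- Targets are missed only as images of the null set of sources that are missed, and `θ` preserves
null sets. -/
theorem null_compl_image_snd_graph {θ : PartialEquiv X X} (hθ : θ ∈ fullPseudogroup R μ)
    (hs : θ.source =ᵐ[μ] univ) (ht : θ.target =ᵐ[μ] univ) :
    μ (Prod.snd '' (graph R ∩ {p | p.1 ∈ θ.source ∧ θ p.1 = p.2}))ᶜ = 0 := by
  set W := graph R ∩ {p | p.1 ∈ θ.source ∧ θ p.1 = p.2} with hW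
  rw [ae_eq_univ] at ht
  have h0 : μ (θ '' (θ.source \ Prod.fst '' W)) = 0 := by
    rw [hθ.1.null_iff _ sdiff_subset]
    exact measure_mono_null (fun x hx => hx.2) (null_compl_image_fst_graph hθ hs)
  refine measure_mono_null ?_ (measure_union_null ht h0)
  intro y hy
  by_cases hyt : y ∈ θ.target
  · refine Or.inr ⟨θ.symm y, ⟨θ.map_target hyt, ?_⟩, θ.right_inv hyt⟩
    rintro ⟨p, hp, hpy⟩
    refine hy ⟨p, hp, ?_⟩
    rw [← hp.2.2, hpy, θ.right_inv hyt]
  · exact Or.inl hyt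

variable [StandardBorelSpace X]

/-- The graph of an element of the full pseudogroup is a bisection. -/
theorem isBisection_graph (hR : IsNonsingular R μ) {θ : PartialEquiv X X}
    (hθ : IsPartialIso μ θ) :
    IsBisection R (graph R ∩ {p | p.1 ∈ θ.source ∧ θ p.1 = p.2}) := by
  refine ⟨hR.measurableSet_graph.inter ?_, inter_subset_left, ?_, ?_⟩
  · have := hθ.measurableSet_source.standardBorel
    have heq : {p : X × X | p.1 ∈ θ.source ∧ θ p.1 = p.2} =
        range fun x : θ.source => ((x : X), θ x) := by
      ext ⟨x, y⟩
      constructor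
      · rintro ⟨h1, h2⟩
        exact ⟨⟨x, h1⟩, Prod.ext rfl h2⟩
      · rintro ⟨z, hz⟩
        obtain ⟨h1, h2⟩ := Prod.ext_iff.1 hz
        obtain rfl : (z : X) = x := h1
        exact ⟨z.2, h2⟩
    rw [heq, ← image_univ]
    exact MeasurableSet.univ.image_of_measurable_injOn
      (measurable_subtype_coe.prodMk hθ.measurable_toFun)
      fun x _ y _ h => Subtype.ext (Prod.ext_iff.1 h).1
  · rintro p ⟨-, -, hp⟩ q ⟨-, -, hq⟩ h
    exact Prod.ext h (by rw [← hp, ← hq, h])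
  · rintro p ⟨-, hps, hp⟩ q ⟨-, hqs, hq⟩ h
    exact Prod.ext (θ.injOn hps hqs (by rw [hp, hq, h])) h

/-- A bisection of full measure is exhausted by its restrictions on which the modulus is
bounded. -/
theorem IsBisection.exists_hasRatio_subset [IsFiniteMeasure μ] (hR : IsNonsingular R μ)
    {P : ℕ → Set (X × X)} (hP : IsBisectionPartition R μ P) {W : Set (X × X)}
    (hW : IsBisection R W) (hfst : μ (Prod.fst '' W)ᶜ = 0) {ε : ENNReal} (hε : 0 < ε) :
    ∃ V ⊆ W, MeasurableSet V ∧ μ (Prod.fst '' V)ᶜ < ε ∧ ∃ K : ℝ, 0 < K ∧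
      HasRatio μ μ (ENNReal.ofReal K⁻¹) (ENNReal.ofReal K) V := by
  have hμ : μ ∈ measureClass μ := ⟨inferInstance, .rfl, .rfl⟩
  set V : ℕ → Set (X × X) := fun n =>
    W ∩ modulus R μ ⁻¹' Icc ((n : ℝ) + 1)⁻¹ ((n : ℝ) + 1) with hV
  have hVb : ∀ n, IsBisection R (V n) := fun n =>
    hW.mono (hW.measurableSet.inter (measurable_modulus R μ measurableSet_Icc)) inter_subset_left
  have hVmono : Monotone V := by
    intro i j hij p hp
    have hij' : (i : ℝ) + 1 ≤ (j : ℝ) + 1 := by gcongr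
    exact ⟨hp.1, (inv_anti₀ (by positivity) hij').trans hp.2.1, hp.2.2.trans hij'⟩
  have hbad : IsBisection R (W ∩ {p | ¬ 0 < modulus R μ p}) :=
    hW.mono (hW.measurableSet.inter
      (measurableSet_lt measurable_const (measurable_modulus R μ)).compl) inter_subset_left
  have hbad0 : μ (Prod.fst '' (W ∩ {p | ¬ 0 < modulus R μ p})) = 0 := by
    rw [hR.null_image_iff hbad.subset_graph, ← hbad.rightMeasure_apply hP .rfl]
    exact measure_mono_null inter_subset_right (ae_iff.1 (ae_modulus_pos hR hP hμ))
  have hlim : μ (⋂ n, (Prod.fst '' V n)ᶜ) = 0 := by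
    refine measure_mono_null ?_ (measure_union_null hfst hbad0)
    intro x hx
    by_cases hxW : x ∈ Prod.fst '' W
    · obtain ⟨p, hp, rfl⟩ := hxW
      refine Or.inr ⟨p, ⟨hp, fun hpos => ?_⟩, rfl⟩
      obtain ⟨n, hn⟩ := exists_nat_ge (max (modulus R μ p) (modulus R μ p)⁻¹)
      refine mem_iInter.1 hx n ⟨p, ⟨hp, ?_, ?_⟩, rfl⟩
      · refine inv_le_of_inv_le₀ hpos (((le_max_right _ _).trans hn).trans ?_)
        exact (lt_add_one _).le
      · exact ((le_max_left _ _).trans hn).trans (lt_add_one _).le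
    · exact Or.inl hxW
  have htend := tendsto_measure_iInter_atTop (μ := μ) (s := fun n => (Prod.fst '' V n)ᶜ)
    (fun n => (hVb n).measurableSet_image_fst.compl.nullMeasurableSet)
    (fun i j hij => compl_subset_compl.2 (image_mono (hVmono hij))) ⟨0, measure_ne_top _ _⟩
  rw [hlim] at htend
  obtain ⟨n, hn⟩ := (htend.eventually_lt_const hε).exists
  refine ⟨V n, inter_subset_left, (hVb n).measurableSet, hn, (n : ℝ) + 1, by positivity, ?_⟩
  have h1 := (hVb n).hasRatio_swap_of_modulus hR hP hμ (c := ((n : ℝ) + 1)⁻¹) (d := (n : ℝ) + 1)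
    fun p hp => hp.2
  -- The interval for the modulus is symmetric under inversion, so undoing the swap returns the same
  -- constants.
  have h2 := h1.swap (by positivity) (by positivity)
  rwa [inv_inv, ← preimage_comp, Prod.swap_swap_eq, preimage_id] at h2

/-- The bounded elements are dense in the full group. -/
theorem dense_isMuBounded [IsProbabilityMeasure μ] (hR : IsNonsingular R μ)
    (hErg : IsErgodic R μ) {P : ℕ → Set (X × X)} (hP : IsBisectionPartition R μ P) {l : ℝ}
    (hType : IsTypeIIIParam R μ l) {C : ℝ} (hC : 0 < C) (hCl : C < l) :
    Dense {θ : FullGroup R μ | IsMuBounded μ θ.1} := by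
  rw [Metric.dense_iff]
  rintro ⟨θ, hθ, hs, ht⟩ r hr
  set W := graph R ∩ {p | p.1 ∈ θ.source ∧ θ p.1 = p.2} with hW
  have hWb : IsBisection R W := isBisection_graph hR hθ.1
  have hW1 : μ (Prod.fst '' W)ᶜ = 0 := null_compl_image_fst_graph hθ hs
  have hW2 : μ (Prod.snd '' W)ᶜ = 0 := null_compl_image_snd_graph hθ hs ht
  obtain ⟨V, hVW, hVm, hVε, K, hK, hVr⟩ :=
    hWb.exists_hasRatio_subset hR hP hW1 (ENNReal.ofReal_pos.2 hr)
  have hVb := hWb.mono hVm hVW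
  set A := (Prod.fst '' V)ᶜ with hAdef
  set B := (Prod.snd '' V)ᶜ with hBdef
  have hAm : MeasurableSet A := hVb.measurableSet_image_fst.compl
  have hBm : MeasurableSet B := hVb.measurableSet_image_snd.compl
  -- Up to null sets, `A` and `B` are the two projections of `W \ V`.
  have hAB : μ A = 0 ↔ μ B = 0 := by
    have hdiff := hR.null_image_iff ((sdiff_subset (t := V)).trans hWb.subset_graph)
    constructor
    · intro h
      refine measure_mono_null ?_ (measure_union_null hW2 (hdiff.1 (measure_mono_null ?_ h)))
      · intro y hy
        by_cases hyW : y ∈ Prod.snd '' W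
        · obtain ⟨p, hp, rfl⟩ := hyW
          exact Or.inr ⟨p, ⟨hp, fun hpV => hy ⟨p, hpV, rfl⟩⟩, rfl⟩
        · exact Or.inl hyW
      · rintro _ ⟨p, ⟨hp, hpV⟩, rfl⟩ ⟨q, hq, hqp⟩
        rw [hWb.injOn_fst (hVW hq) hp hqp] at hq
        exact hpV hq
    · intro h
      refine measure_mono_null ?_ (measure_union_null hW1 (hdiff.2 (measure_mono_null ?_ h)))
      · intro y hy
        by_cases hyW : y ∈ Prod.fst '' W
        · obtain ⟨p, hp, rfl⟩ := hyW
          exact Or.inr ⟨p, ⟨hp, fun hpV => hy ⟨p, hpV, rfl⟩⟩, rfl⟩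
        · exact Or.inl hyW
      · rintro _ ⟨p, ⟨hp, hpV⟩, rfl⟩ ⟨q, hq, hqp⟩
        rw [hWb.injOn_snd (hVW hq) hp hqp] at hq
        exact hpV hq
  -- Comparison needs nonnull sets; if the leftover sets are null, the empty bisection does.
  obtain ⟨H, hHs, hHb, a, b, ha, hb, hHr, hHA, hHB⟩ : ∃ H ⊆ A ×ˢ B, IsBisection R H ∧
      ∃ a b : ℝ, 0 < a ∧ 0 < b ∧ HasRatio μ μ (ENNReal.ofReal a) (ENNReal.ofReal b) H ∧
      μ (A \ Prod.fst '' H) = 0 ∧ μ (B \ Prod.snd '' H) = 0 := by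
    by_cases hA0 : μ A = 0
    · refine ⟨∅, empty_subset _, hVb.mono MeasurableSet.empty (empty_subset _), 1, 1, one_pos,
        one_pos, fun U hU _ => ?_, measure_mono_null sdiff_subset hA0,
        measure_mono_null sdiff_subset (hAB.1 hA0)⟩
      rw [subset_empty_iff.1 hU]
      simp
    · have hB0 : μ B ≠ 0 := fun h => hA0 (hAB.2 h)
      obtain ⟨H, h1, h2, h3, h4⟩ := exists_hasRatio_full hR hErg hP hType hC hCl hAm hBm hA0 hB0
      have hAr : 0 < μ.real A := ENNReal.toReal_pos hA0 (measure_ne_top _ _)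
      have hBr : 0 < μ.real B := ENNReal.toReal_pos hB0 (measure_ne_top _ _)
      exact ⟨H, h1, h2, _, _, by positivity, by positivity, h3, h4⟩
  have hfst : Disjoint (Prod.fst '' V) (Prod.fst '' H) := by
    refine disjoint_left.2 ?_
    rintro _ hx ⟨p, hp, rfl⟩
    exact (hHs hp).1 hx
  have hsnd : Disjoint (Prod.snd '' V) (Prod.snd '' H) := by
    refine disjoint_left.2 ?_
    rintro _ hx ⟨p, hp, rfl⟩
    exact (hHs hp).2 hx
  have hU : IsBisection R (V ∪ H) := hVb.union hHb hfst hsnd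
  have hUr : HasRatio μ μ (ENNReal.ofReal (min K⁻¹ a)) (ENNReal.ofReal (max K b)) (V ∪ H) :=
    HasRatio.union hVb hHb hfst hsnd
      (hVr.weaken (ENNReal.ofReal_le_ofReal (min_le_left _ _))
        (ENNReal.ofReal_le_ofReal (le_max_left _ _)))
      (hHr.weaken (ENNReal.ofReal_le_ofReal (min_le_right _ _))
        (ENNReal.ofReal_le_ofReal (le_max_right _ _)))
  have hsrc : hU.toPartialEquiv.source =ᵐ[μ] univ := by
    rw [ae_eq_univ]
    refine measure_mono_null ?_ hHA
    intro x hx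
    refine ⟨fun hxV => hx ?_, fun hxH => hx ?_⟩
    · exact image_mono subset_union_left hxV
    · exact image_mono subset_union_right hxH
  have htgt : hU.toPartialEquiv.target =ᵐ[μ] univ := by
    rw [ae_eq_univ]
    refine measure_mono_null ?_ hHB
    intro x hx
    refine ⟨fun hxV => hx ?_, fun hxH => hx ?_⟩
    · exact image_mono subset_union_left hxV
    · exact image_mono subset_union_right hxH
  refine ⟨⟨hU.toPartialEquiv, hU.toPartialEquiv_mem hR, hsrc, htgt⟩, ?_,
    hU.isMuBounded (lt_min (inv_pos.2 hK) ha) (hb.le.trans (le_max_right _ _)) hUr⟩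
  refine Metric.mem_ball.2 ?_
  change μ.real {x | hU.toPartialEquiv x ≠ θ x} < r
  refine (ENNReal.toReal_lt_of_lt_ofReal hVε).trans_le' (measureReal_mono fun x hx => ?_)
  rintro ⟨p, hp, rfl⟩
  refine hx ?_
  rw [hU.toPartialEquiv_apply (Or.inl hp)]
  exact (hVW hp).2.2.symm

end FullGroup

end NonsingularRelation

/-! ### The main theorem -/

theorem mainTheorem7 {X : Type*} [MeasurableSpace X] [StandardBorelSpace X]
    (μ : MeasureTheory.Measure X) [MeasureTheory.IsProbabilityMeasure μ] (R : Setoid X)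
    (hR : NonsingularRelation.IsNonsingular R μ)
    (hErg : NonsingularRelation.IsErgodic R μ)
    (l : ℝ) (hType : NonsingularRelation.IsTypeIIIParam R μ l) :
    (∀ A B : Set X, MeasurableSet A → MeasurableSet B → μ A ≠ 0 → μ B ≠ 0 →
      (∃ θ ∈ NonsingularRelation.fullPseudogroup R μ,
        θ.source =ᵐ[μ] A ∧ θ.target =ᵐ[μ] B ∧ NonsingularRelation.IsMuBounded μ θ) ∧
      ∀ C : ℝ, 0 < C → C < l →
        ∃ θ ∈ NonsingularRelation.fullPseudogroup R μ,
          θ.source =ᵐ[μ] A ∧ θ.target =ᵐ[μ] B ∧ NonsingularRelation.IsMuBounded μ θ ∧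
          ∀ᵐ x ∂μ, x ∈ A →
            C * (μ.real B / μ.real A) ≤ NonsingularRelation.derivative μ θ x ∧
            NonsingularRelation.derivative μ θ x ≤ C⁻¹ * (μ.real B / μ.real A)) ∧
    Dense {θ : NonsingularRelation.FullGroup R μ | NonsingularRelation.IsMuBounded μ θ.1} := by
  obtain ⟨P, hP⟩ := hR.exists_isBisectionPartition
  have hl : 0 < l := by
    rcases hType.2 with ⟨h, -⟩ | ⟨rfl, -⟩
    exacts [h, one_pos]
  -- Density does not depend on the constant; `l / 2` is merely some value in `(0, l)`.
  refine ⟨fun A B hA hB hA0 hB0 => ?_, NonsingularRelation.dense_isMuBounded hR hErg hP hType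
    (half_pos hl) (half_lt_self hl)⟩
  have key : ∀ C : ℝ, 0 < C → C < l →
      ∃ θ ∈ NonsingularRelation.fullPseudogroup R μ,
        θ.source =ᵐ[μ] A ∧ θ.target =ᵐ[μ] B ∧ NonsingularRelation.IsMuBounded μ θ ∧
        ∀ᵐ x ∂μ, x ∈ A →
          C * (μ.real B / μ.real A) ≤ NonsingularRelation.derivative μ θ x ∧
          NonsingularRelation.derivative μ θ x ≤ C⁻¹ * (μ.real B / μ.real A) := by
    intro C hC hCl
    have hAr : 0 < μ.real A := ENNReal.toReal_pos hA0 (measure_ne_top _ _)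
    have hBr : 0 < μ.real B := ENNReal.toReal_pos hB0 (measure_ne_top _ _)
    obtain ⟨H, hHs, hHb, hHr, hHA, hHB⟩ :=
      NonsingularRelation.exists_hasRatio_full hR hErg hP hType hC hCl hA hB hA0 hB0
    have hsub1 : Prod.fst '' H ⊆ A := by rintro _ ⟨p, hp, rfl⟩; exact (hHs hp).1
    have hsub2 : Prod.snd '' H ⊆ B := by rintro _ ⟨p, hp, rfl⟩; exact (hHs hp).2
    refine ⟨hHb.toPartialEquiv, hHb.toPartialEquiv_mem hR,
      hsub1.eventuallyLE.antisymm (ae_le_set.2 hHA), hsub2.eventuallyLE.antisymm (ae_le_set.2 hHB),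
      hHb.isMuBounded (by positivity) (by positivity) hHr, ?_⟩
    filter_upwards [hHb.ae_derivative_mem_Icc (by positivity) hHr,
      measure_eq_zero_iff_ae_notMem.1 hHA] with x h1 h2 hx
    refine h1 ?_
    by_contra h
    exact h2 ⟨hx, h⟩
  refine ⟨?_, key⟩
  obtain ⟨θ, h1, h2, h3, h4, -⟩ := key (l / 2) (half_pos hl) (half_lt_self hl)
  exact ⟨θ, h1, h2, h3, h4⟩
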